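/- For $k\in(0,1)$ let $$K(k)=\int_0^1\frac{dt}{\sqrt{1-t^2}\sqrt{1-k^2t^2}},\qquad E(k)=\int_0^1\frac{\sqrt{1-k^2t^2}}{\sqrt{1-t^2}}\,dt$$ be the complete elliptic integrals of the first and second kind, and let $\operatorname{sn}(t,k)=\sin\operatorname{am}(t,k)$ be the Jacobian elliptic function, where Jacobi's amplitude $\operatorname{am}(\cdot,k)$ is the inverse function of $\varphi\mapsto\int_0^\varphi(1-k^2\sin^2\theta)^{-1/2}\,d\theta$ on $\mathbb R$. For $h,\nu\in\mathbb R$, Lamé's equation $$y''+\bigl(h-\nu(\nu+1)k^2\operatorname{sn}^2(t,k)\bigr)y=0$$ has a coefficient of period $2K(k)$; its Hill discriminant $D(h,\nu,k)$ is the trace of the endomorphism $w(t)\mapsto w(t+2K(k))$ of the two-dimensional space of its solutions on $\mathbb R$. If $h>\nu(\nu+1)$, put $$\omega=\sqrt{h-\nu(\nu+1)}>0,\qquad \mu=i\omega,\qquad B=\frac{\Gamma(1+\mu)\,\Gamma(\mu)}{\Gamma(1+\mu+\nu)\,\Gamma(\mu-\nu)}.$$ (a) Suppose $\nu\ge 0$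 and $h>\nu(\nu+1)$. Then, for all $k\in(0,1)$, $$\bigl|D(h,\nu,k)-2\operatorname{Re}\bigl(Be^{2i\omega K(k)}\bigr)\bigr|\le 8h^{1/2}\omega^{-2}\,\nu(\nu+1)\,\bigl(E(k)+1-2\tanh K(k)\bigr).$$ (b) Suppose $\nu\in[-\tfrac12,0)$ and $h>0$ (so that $h>\nu(\nu+1)$ holds automatically). Then, for all $k\in(0,1)$, $$\bigl|D(h,\nu,k)-2\operatorname{Re}\bigl(Be^{2i\omega K(k)}\bigr)\bigr|\le 8\,\omega h^{-1}\,|\nu|(\nu+1)\,\bigl(E(k)+1-2\tanh K(k)\bigr).$$ -/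

import Mathlib

noncomputable section

namespace Lame

/-! ### Hill's equation `y'' + q y = 0` and its discriminant -/

/-- The space of real solutions, on the whole real line, of `y'' + q(t) y = 0`. -/
def solutionSpace (q : ℝ → ℝ) : Submodule ℝ (ℝ → ℝ) where
  carrier := {y | Differentiable ℝ y ∧ Differentiable ℝ (deriv y) ∧
    ∀ t, deriv (deriv y) t + q t * y t = 0}
  zero_mem' := by
    have h0 : deriv (0 : ℝ → ℝ) = 0 := by
      funext t
      simp
    refine ⟨differentiable_const (0 : ℝ), ?_, ?_⟩
    · rw [h0]
      exact differentiable_const (0 : ℝ)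
    · intro t
      simp [h0]
  add_mem' := by
    rintro y z ⟨hy, hy', hy''⟩ ⟨hz, hz', hz''⟩
    have h1 : deriv (y + z) = deriv y + deriv z := by
      funext t
      exact deriv_add (hy t) (hz t)
    refine ⟨hy.add hz, ?_, ?_⟩
    · rw [h1]
      exact hy'.add hz'
    · intro t
      rw [h1, deriv_add (hy' t) (hz' t), Pi.add_apply]
      linear_combination hy'' t + hz'' t
  smul_mem' := by
    rintro c y ⟨hy, hy', hy''⟩
    have h1 : deriv (c • y) = c • deriv y := by
      funext t
      exact deriv_const_smul c (hy t)
    refine ⟨hy.const_smul c, ?_, ?_⟩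
    · rw [h1]
      exact hy'.const_smul c
    · intro t
      rw [h1, deriv_const_smul c (hy' t), Pi.smul_apply, smul_eq_mul, smul_eq_mul]
      linear_combination c * hy'' t

/-- If `q` has period `σ`, then `w(t) ↦ w(t + σ)` maps solutions to solutions. -/
theorem translate_mem {q : ℝ → ℝ} {σ : ℝ} (hq : Function.Periodic q σ) {y : ℝ → ℝ}
    (hy : y ∈ solutionSpace q) : (fun t => y (t + σ)) ∈ solutionSpace q := by
  obtain ⟨h1, h2, h3⟩ := hy
  have hd : deriv (fun t => y (t + σ)) = fun t => deriv y (t + σ) := by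
    funext t
    exact deriv_comp_add_const y σ t
  refine ⟨h1.comp (differentiable_id.add_const σ), ?_, ?_⟩
  · rw [hd]
    exact h2.comp (differentiable_id.add_const σ)
  · intro t
    rw [hd, deriv_comp_add_const, ← hq t]
    exact h3 (t + σ)

/-- The endomorphism `w(t) ↦ w(t + σ)` of the solution space of `y'' + q(t) y = 0`,
where `q` has period `σ`. -/
def translation (q : ℝ → ℝ) (σ : ℝ) (hq : Function.Periodic q σ) :
    solutionSpace q →ₗ[ℝ] solutionSpace q where
  toFun y := ⟨fun t => (y : ℝ → ℝ) (t + σ), translate_mem hq y.2⟩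
  map_add' _ _ := rfl
  map_smul' _ _ := rfl

/-- The Hill discriminant of `y'' + q(t) y = 0`, where `q` has period `σ`: the trace of the
endomorphism `w(t) ↦ w(t + σ)` of the solution space. -/
def hillDiscriminant (q : ℝ → ℝ) (σ : ℝ) (hq : Function.Periodic q σ) : ℝ :=
  LinearMap.trace ℝ (solutionSpace q) (translation q σ hq)

/-! ### Elliptic integrals and Jacobian elliptic functions -/

/-- Complete elliptic integral of the first kind. -/
def ellipticK (k : ℝ) : ℝ :=
  ∫ t in (0 : ℝ)..1, 1 / (√(1 - t ^ 2) * √(1 - k ^ 2 * t ^ 2))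

/-- Complete elliptic integral of the second kind. -/
def ellipticE (k : ℝ) : ℝ :=
  ∫ t in (0 : ℝ)..1, √(1 - k ^ 2 * t ^ 2) / √(1 - t ^ 2)

/-- Incomplete elliptic integral of the first kind, as a function of the amplitude `φ`. -/
def ellipticF (k φ : ℝ) : ℝ :=
  ∫ θ in (0 : ℝ)..φ, 1 / √(1 - k ^ 2 * Real.sin θ ^ 2)

/-- Jacobi's amplitude function `am(·, k)`: the inverse function of `φ ↦ F(φ, k)`, which for
`0 < k < 1` is a bijection of the real line (`ellipticF_bijective`). -/
def jacobiAm (k : ℝ) : ℝ → ℝ :=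
  Function.invFun (ellipticF k)

/-- The Jacobian elliptic function `sn(t, k) = sin am(t, k)`. -/
def jacobiSn (t k : ℝ) : ℝ :=
  Real.sin (jacobiAm k t)

theorem one_sub_pos {k : ℝ} (hk : k ∈ Set.Ioo (0 : ℝ) 1) (θ : ℝ) :
    0 < 1 - k ^ 2 * Real.sin θ ^ 2 := by
  have h1 : k ^ 2 < 1 := by nlinarith [hk.1, hk.2]
  nlinarith [Real.sin_sq_le_one θ, sq_nonneg (Real.sin θ), sq_nonneg k]

theorem continuous_integrand {k : ℝ} (hk : k ∈ Set.Ioo (0 : ℝ) 1) :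
    Continuous fun θ : ℝ => 1 / √(1 - k ^ 2 * Real.sin θ ^ 2) := by
  refine continuous_const.div (by fun_prop) fun θ => ?_
  exact (Real.sqrt_pos.2 (one_sub_pos hk θ)).ne'

theorem one_le_integrand {k : ℝ} (hk : k ∈ Set.Ioo (0 : ℝ) 1) (θ : ℝ) :
    1 ≤ 1 / √(1 - k ^ 2 * Real.sin θ ^ 2) := by
  rw [le_div_iff₀ (Real.sqrt_pos.2 (one_sub_pos hk θ)), one_mul, Real.sqrt_le_iff]
  refine ⟨zero_le_one, ?_⟩
  nlinarith [mul_nonneg (sq_nonneg k) (sq_nonneg (Real.sin θ))]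

theorem ellipticF_sub_ge {k : ℝ} (hk : k ∈ Set.Ioo (0 : ℝ) 1) {a b : ℝ} (hab : a ≤ b) :
    b - a ≤ ellipticF k b - ellipticF k a := by
  have hc := continuous_integrand hk
  unfold ellipticF
  rw [intervalIntegral.integral_interval_sub_left (hc.intervalIntegrable _ _)
    (hc.intervalIntegrable _ _)]
  calc b - a = ∫ _ in a..b, (1 : ℝ) := by simp
    _ ≤ _ := intervalIntegral.integral_mono_on hab (by simp) (hc.intervalIntegrable _ _)
      fun θ _ => one_le_integrand hk θ

theorem ellipticF_zero (k : ℝ) : ellipticF k 0 = 0 := by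
  simp [ellipticF]

/-- For `0 < k < 1` the map `φ ↦ F(φ, k)` is a bijection of the real line. -/
theorem ellipticF_bijective {k : ℝ} (hk : k ∈ Set.Ioo (0 : ℝ) 1) :
    Function.Bijective (ellipticF k) := by
  constructor
  · intro a b hab
    rcases le_total a b with h | h
    · linarith [ellipticF_sub_ge hk h]
    · linarith [ellipticF_sub_ge hk h]
  · have hcont : Continuous (ellipticF k) :=
      intervalIntegral.continuous_primitive
        (fun a b => (continuous_integrand hk).intervalIntegrable a b) 0
    refine hcont.surjective ?_ ?_
    · refine Filter.tendsto_atTop_mono' _ ?_ Filter.tendsto_id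
      filter_upwards [Filter.eventually_ge_atTop (0 : ℝ)] with x hx
      have := ellipticF_sub_ge hk hx
      rw [ellipticF_zero] at this
      simpa using this
    · refine Filter.tendsto_atBot_mono' _ ?_ Filter.tendsto_id
      filter_upwards [Filter.eventually_le_atBot (0 : ℝ)] with x hx
      have := ellipticF_sub_ge hk hx
      rw [ellipticF_zero] at this
      simpa using this

theorem ellipticF_jacobiAm {k : ℝ} (hk : k ∈ Set.Ioo (0 : ℝ) 1) (t : ℝ) :
    ellipticF k (jacobiAm k t) = t :=
  Function.rightInverse_invFun (ellipticF_bijective hk).2 t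

/-- The substitution `t = sin θ`. -/
theorem ellipticF_pi_div_two {k : ℝ} (hk : k ∈ Set.Ioo (0 : ℝ) 1) :
    ellipticF k (Real.pi / 2) = ellipticK k := by
  have hpi := Real.pi_pos
  have himg : Real.sin '' Set.Ioo 0 (Real.pi / 2) = Set.Ioo (0 : ℝ) 1 := by
    ext x
    constructor
    · rintro ⟨θ, hθ, rfl⟩
      refine ⟨Real.sin_pos_of_pos_of_lt_pi hθ.1 (by linarith [hθ.2]), ?_⟩
      have := Real.strictMonoOn_sin (a := θ) (b := Real.pi / 2)
        ⟨by linarith [hθ.1], hθ.2.le⟩ ⟨by linarith, le_rfl⟩ hθ.2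
      simpa using this
    · intro hx
      refine ⟨Real.arcsin x, ⟨Real.arcsin_pos.2 hx.1, Real.arcsin_lt_pi_div_two.2 hx.2⟩,
        Real.sin_arcsin (by linarith [hx.1]) hx.2.le⟩
  have hinj : Set.InjOn Real.sin (Set.Ioo 0 (Real.pi / 2)) :=
    Real.strictMonoOn_sin.injOn.mono fun θ hθ =>
      Set.mem_Icc.2 ⟨by linarith [hθ.1], hθ.2.le⟩
  have key := MeasureTheory.integral_image_eq_integral_abs_deriv_smul
    (s := Set.Ioo 0 (Real.pi / 2)) (f := Real.sin) (f' := Real.cos) measurableSet_Ioo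
    (fun θ _ => (Real.hasDerivAt_sin θ).hasDerivWithinAt) hinj
    (fun t => 1 / (√(1 - t ^ 2) * √(1 - k ^ 2 * t ^ 2)))
  rw [himg] at key
  unfold ellipticF ellipticK
  rw [intervalIntegral.integral_of_le (by linarith), intervalIntegral.integral_of_le zero_le_one,
    MeasureTheory.integral_Ioc_eq_integral_Ioo, MeasureTheory.integral_Ioc_eq_integral_Ioo, key]
  refine MeasureTheory.setIntegral_congr_fun measurableSet_Ioo fun θ hθ => ?_
  have hcos : 0 < Real.cos θ := Real.cos_pos_of_mem_Ioo ⟨by linarith [hθ.1], hθ.2⟩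
  have h1 : √(1 - Real.sin θ ^ 2) = Real.cos θ := by
    rw [← Real.cos_sq', Real.sqrt_sq hcos.le]
  have h2 := Real.sqrt_pos.2 (one_sub_pos hk θ)
  simp only [h1, abs_of_pos hcos, smul_eq_mul]
  field_simp

theorem ellipticF_add_pi {k : ℝ} (hk : k ∈ Set.Ioo (0 : ℝ) 1) (φ : ℝ) :
    ellipticF k (φ + Real.pi) = ellipticF k φ + 2 * ellipticK k := by
  have hc := continuous_integrand hk
  have hper : Function.Periodic (fun θ : ℝ => 1 / √(1 - k ^ 2 * Real.sin θ ^ 2)) Real.pi := by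
    intro θ
    simp [Real.sin_add_pi]
  have h1 : ellipticF k (φ + Real.pi) - ellipticF k φ = ellipticF k Real.pi := by
    unfold ellipticF
    rw [intervalIntegral.integral_interval_sub_left (hc.intervalIntegrable _ _)
      (hc.intervalIntegrable _ _), hper.intervalIntegral_add_eq φ 0, zero_add]
  have h2 : ellipticF k Real.pi - ellipticF k (Real.pi / 2) = ellipticF k (Real.pi / 2) := by
    unfold ellipticF
    rw [intervalIntegral.integral_interval_sub_left (hc.intervalIntegrable _ _)
      (hc.intervalIntegrable _ _)]
    have := intervalIntegral.integral_comp_sub_left (a := Real.pi / 2) (b := Real.pi)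
      (fun θ : ℝ => 1 / √(1 - k ^ 2 * Real.sin θ ^ 2)) Real.pi
    simp only [Real.sin_pi_sub, sub_self] at this
    rw [this]
    congr 1
    ring
  rw [← ellipticF_pi_div_two hk]
  linarith

/-! ### Lamé's equation -/

/-- The coefficient `h - ν (ν + 1) k² sn²(t, k)` of Lamé's equation. -/
def lameCoeff (h ν k t : ℝ) : ℝ :=
  h - ν * (ν + 1) * k ^ 2 * jacobiSn t k ^ 2

/-- Lamé's equation is a Hill equation with period `2 K(k)`. -/
theorem lameCoeff_periodic (h ν : ℝ) {k : ℝ} (hk : k ∈ Set.Ioo (0 : ℝ) 1) :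
    Function.Periodic (lameCoeff h ν k) (2 * ellipticK k) := by
  intro t
  have ham : jacobiAm k (t + 2 * ellipticK k) = jacobiAm k t + Real.pi := by
    apply (ellipticF_bijective hk).1
    rw [ellipticF_jacobiAm hk, ellipticF_add_pi hk, ellipticF_jacobiAm hk]
  simp [lameCoeff, jacobiSn, ham, Real.sin_add_pi]

/-- The Hill discriminant `D(h, ν, k)` of Lamé's equation
`y'' + (h - ν (ν + 1) k² sn²(t, k)) y = 0`, `0 < k < 1`, with respect to the period `2 K(k)`. -/
def lameDiscriminant (h ν k : ℝ) (hk : k ∈ Set.Ioo (0 : ℝ) 1) : ℝ :=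
  hillDiscriminant (lameCoeff h ν k) (2 * ellipticK k) (lameCoeff_periodic h ν hk)

/-- `ω = √(h - ν (ν + 1))`. -/
def lameOmega (h ν : ℝ) : ℝ :=
  √(h - ν * (ν + 1))

/-- `B = Γ(1 + μ) Γ(μ) / (Γ(1 + μ + ν) Γ(μ - ν))` with `μ = i ω`. -/
def lameB (h ν : ℝ) : ℂ :=
  Complex.Gamma (1 + Complex.I * lameOmega h ν) * Complex.Gamma (Complex.I * lameOmega h ν) /
    (Complex.Gamma (1 + Complex.I * lameOmega h ν + ν) *
      Complex.Gamma (Complex.I * lameOmega h ν - ν))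

end Lame

end

noncomputable section

namespace Lame

open Filter Topology MeasureTheory

/-! Write q for the Lamé coefficient and p = h - ν(ν+1) tanh² for its limit as k → 1. For an even
coefficient of period 2K the discriminant is 2(y z' + y' z)(K), with y, z the even and odd
normalized solutions (`hillDiscriminant_eq`). Each solution is encoded by its complex amplitude
relative to e^{iωt}; if α, β are the amplitudes of y, z at K, then D = 2 Re(iω α β e^{2iωK})
(`re_amplitude_mul`). For the limiting equation the amplitudes of the solutions with the same
initial data converge at +∞ to numbers a, b with iω a b = B (`exists_limit_solutions`). So it
suffices to bound α - a and β - b.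

Comparison. If v solves the limiting equation with the data of y, then y - v solves the Lamé
equation with source (p - q) v. Since 0 ≤ k sn ≤ tanh on [0, K] (`mul_jacobiSn_le_tanh`), an energy
estimate bounds y - v at K through the integral of tanh² - k² sn² over [0, K], which is E - tanh K.
Beyond K the amplitude of v still moves by at most a multiple of the integral of 1 - tanh² over [K,
∞), which is 1 - tanh K. The two add up to E + 1 - 2 tanh K. The sign of ν(ν+1) decides whether q
and p decrease or increase on [0, K], hence whether the energy is z'² + Q z² or z² + z'²/Q; this is
the source of the two cases.

Evaluation of a b. With z = (1 - tanh t)/2 the Jost solution f ~ e^{-iωt} of the limiting equation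
is e^{-iωt} ₂F₁(-ν, ν+1; 1+iω; z), and a b is a multiple of f(0) f'(0). As a function of c = 1 + μ,
the product -f(0) f'(0) satisfies a one-step recurrence with rational coefficients
(`jostProduct_rec`). Together with its behaviour as c → ∞ along integer translates, this gives the
Gamma quotient by Gauss's limit formula (`jostProduct_eq_Gamma`), without a summation theorem for
₂F₁ at 1/2. -/

/-- The iterated integrals `uₙ₊₁(t) = ∫₀ᵗ A(s) uₙ(s) ds`, `u₀ = x`. -/
def picardTerm {E : Type*} [NormedAddCommGroup E] [NormedSpace ℝ E] (A : ℝ → E →L[ℝ] E) (x : E) :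
    ℕ → ℝ → E
  | 0 => fun _ => x
  | n + 1 => fun t => ∫ s in (0 : ℝ)..t, A s (picardTerm A x n s)

/-! ### Picard series for linear systems. -/

section LinearODE

variable {E : Type*} [NormedAddCommGroup E] [NormedSpace ℝ E] {A : ℝ → E →L[ℝ] E}

theorem continuous_picardTerm (hA : Continuous A) (x : E) (n : ℕ) :
    Continuous (picardTerm A x n) := by
  induction n with
  | zero => exact continuous_const
  | succ n ih =>
    exact intervalIntegral.continuous_primitive
      (fun a b => (hA.clm_apply ih).intervalIntegrable a b) 0

/-- Each integration raises the power of |t| by one and divides by the new exponent, which produces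
the factorial and so convergence for all t. -/
theorem norm_picardTerm_le {M : ℝ} (hA : Continuous A) (hM : ∀ t, ‖A t‖ ≤ M) (x : E) (n : ℕ)
    (t : ℝ) : ‖picardTerm A x n t‖ ≤ ‖x‖ * ((M * |t|) ^ n / n.factorial) := by
  have hM0 : 0 ≤ M := (norm_nonneg _).trans (hM 0)
  induction n generalizing t with
  | zero => simp [picardTerm]
  | succ n ih =>
    have hc := hA.clm_apply (continuous_picardTerm hA x n)
    calc ‖picardTerm A x (n + 1) t‖
        ≤ ∫ s in Set.uIoc 0 t, ‖A s (picardTerm A x n s)‖ :=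
          intervalIntegral.norm_integral_le_integral_norm_uIoc
      _ ≤ ∫ s in Set.uIoc 0 t, (‖x‖ * M ^ (n + 1) / n.factorial) * |s - 0| ^ n := by
          refine setIntegral_mono_on ?_ ?_ measurableSet_uIoc fun s _ => ?_
          · exact (hc.norm.intervalIntegrable 0 t).def'
          · exact (Continuous.intervalIntegrable (by fun_prop) 0 t).def'
          · calc ‖A s (picardTerm A x n s)‖ ≤ ‖A s‖ * ‖picardTerm A x n s‖ := (A s).le_opNorm _
              _ ≤ M * (‖x‖ * ((M * |s|) ^ n / n.factorial)) :=
                mul_le_mul (hM s) (ih s) (norm_nonneg _) hM0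
              _ = _ := by rw [sub_zero, mul_pow]; ring
      _ = ‖x‖ * ((M * |t|) ^ (n + 1) / (n + 1).factorial) := by
          rw [integral_const_mul, integral_pow_abs_sub_uIoc, Nat.factorial_succ, sub_zero, mul_pow]
          push_cast
          have : (n.factorial : ℝ) ≠ 0 := by positivity
          field_simp

variable [CompleteSpace E]

theorem hasDerivAt_picardTerm (hA : Continuous A) (x : E) (n : ℕ) (t : ℝ) :
    HasDerivAt (picardTerm A x (n + 1)) (A t (picardTerm A x n t)) t :=
  (hA.clm_apply (continuous_picardTerm hA x n)).integral_hasStrictDerivAt 0 t |>.hasDerivAt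

/-- Global existence for a linear differential equation with bounded coefficients. -/
theorem exists_linearODE_solution {M : ℝ} (hA : Continuous A) (hM : ∀ t, ‖A t‖ ≤ M) (x : E) :
    ∃ Y : ℝ → E, Y 0 = x ∧ ∀ t, HasDerivAt Y (A t (Y t)) t := by
  have hM0 : 0 ≤ M := (norm_nonneg _).trans (hM 0)
  have hsum (R : ℝ) : Summable fun n : ℕ => ‖x‖ * ((M * R) ^ n / n.factorial) :=
    (Real.summable_pow_div_factorial _).mul_left _
  have hs (t : ℝ) : Summable fun n => picardTerm A x n t :=
    .of_norm_bounded (hsum |t|) fun n => norm_picardTerm_le hA hM x n t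
  have h0 (t : ℝ) : ∑' n, picardTerm A x n t = x + ∑' n, picardTerm A x (n + 1) t :=
    (hs t).tsum_eq_zero_add
  refine ⟨fun t => ∑' n, picardTerm A x n t, ?_, fun t => ?_⟩
  · simp [h0, picardTerm]
  · have hd : HasDerivAt (fun s => ∑' n, picardTerm A x (n + 1) s)
        (∑' n, A t (picardTerm A x n t)) t := by
      -- The majorant is uniform only on bounded sets, so termwise differentiation is done on the
      -- ball of radius |t| + 1, which contains t.
      refine hasDerivAt_tsum_of_isPreconnected ((hsum (|t| + 1)).mul_left M)
        (Metric.isOpen_ball (x := (0 : ℝ)) (ε := |t| + 1)) (convex_ball _ _).isPreconnected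
        (fun n s _ => hasDerivAt_picardTerm hA x n s) (fun n s hs => ?_) (y₀ := t) (by simp)
        ((summable_nat_add_iff 1).2 (hs t)) (by simp)
      have hs' : |s| ≤ |t| + 1 := by simpa using (mem_ball_zero_iff.1 hs).le
      refine ((A s).le_opNorm _).trans (mul_le_mul (hM s) ?_ (norm_nonneg _) hM0)
      refine (norm_picardTerm_le hA hM x n s).trans ?_
      gcongr
    simp_rw [h0]
    rw [← h0, (A t).map_tsum (hs t)]
    exact hd.const_add x

end LinearODE

/-! ### Hill's equation with an even periodic coefficient. -/

section Hill

variable {q : ℝ → ℝ}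

/-- The companion matrix of `y'' + q y = 0`, acting on `(y, y')`. -/
def hillSystem (q : ℝ → ℝ) (t : ℝ) : ℝ × ℝ →L[ℝ] ℝ × ℝ :=
  (ContinuousLinearMap.snd ℝ ℝ ℝ).prod (-(q t) • ContinuousLinearMap.fst ℝ ℝ ℝ)

theorem continuous_hillSystem (hq : Continuous q) : Continuous (hillSystem q) := by
  have : hillSystem q = fun t => (ContinuousLinearMap.inl ℝ ℝ ℝ).comp
      (ContinuousLinearMap.snd ℝ ℝ ℝ) + (-(q t)) • ((ContinuousLinearMap.inr ℝ ℝ ℝ).comp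
      (ContinuousLinearMap.fst ℝ ℝ ℝ)) := by
    funext t
    ext <;> simp [hillSystem]
  rw [this]
  fun_prop

theorem norm_hillSystem_le {M : ℝ} (hM : ∀ t, |q t| ≤ M) (t : ℝ) :
    ‖hillSystem q t‖ ≤ max 1 M := by
  refine ContinuousLinearMap.opNorm_le_bound _ (by positivity) fun x => ?_
  have h1 : ‖x.1‖ ≤ ‖x‖ := norm_fst_le x
  have h2 : ‖x.2‖ ≤ ‖x‖ := norm_snd_le x
  refine max_le ?_ ?_
  · change ‖x.2‖ ≤ _
    calc ‖x.2‖ ≤ 1 * ‖x‖ := by simpa using h2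
      _ ≤ _ := by gcongr; exact le_max_left _ _
  · change ‖-(q t) * x.1‖ ≤ _
    rw [norm_mul, norm_neg]
    exact mul_le_mul ((hM t).trans (le_max_right _ _)) h1 (norm_nonneg _) (by positivity)

theorem exists_hill_solution {M : ℝ} (hq : Continuous q) (hM : ∀ t, |q t| ≤ M) (a b : ℝ) :
    ∃ y ∈ solutionSpace q, y 0 = a ∧ deriv y 0 = b := by
  obtain ⟨Y, h0, hY⟩ := exists_linearODE_solution (continuous_hillSystem hq)
    (norm_hillSystem_le hM) (a, b)
  have h1 (t : ℝ) : HasDerivAt (fun t => (Y t).1) (Y t).2 t := by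
    simpa [hillSystem, Function.comp_def] using
      (ContinuousLinearMap.fst ℝ ℝ ℝ).hasFDerivAt.comp_hasDerivAt t (hY t)
  have h2 (t : ℝ) : HasDerivAt (fun t => (Y t).2) (-(q t) * (Y t).1) t := by
    simpa [hillSystem, Function.comp_def] using
      (ContinuousLinearMap.snd ℝ ℝ ℝ).hasFDerivAt.comp_hasDerivAt t (hY t)
  have hd : deriv (fun t => (Y t).1) = fun t => (Y t).2 := funext fun t => (h1 t).deriv
  refine ⟨fun t => (Y t).1, ⟨fun t => (h1 t).differentiableAt, ?_, fun t => ?_⟩, by simp [h0], ?_⟩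
  · rw [hd]
    exact fun t => (h2 t).differentiableAt
  · rw [hd, (h2 t).deriv]
    ring
  · simp [hd, h0]

theorem hill_solution_ext {M : ℝ} (hM : ∀ t, |q t| ≤ M) {y z : ℝ → ℝ}
    (hy : y ∈ solutionSpace q) (hz : z ∈ solutionSpace q) (h0 : y 0 = z 0)
    (h1 : deriv y 0 = deriv z 0) : y = z := by
  have key {y : ℝ → ℝ} (hy : y ∈ solutionSpace q) (t : ℝ) :
      HasDerivAt (fun t => (y t, deriv y t)) (hillSystem q t (y t, deriv y t)) t := by
    have h := (hy.1 t).hasDerivAt.prodMk (hy.2.1 t).hasDerivAt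
    have e : deriv (deriv y) t = -(q t) * y t := by linear_combination hy.2.2 t
    simpa [hillSystem, e] using h
  have hL (t : ℝ) : LipschitzWith (max 1 M).toNNReal (hillSystem q t) := by
    refine (hillSystem q t).lipschitz.weaken ?_
    rw [← NNReal.coe_le_coe, Real.coe_toNNReal _ (by positivity)]
    exact norm_hillSystem_le hM t
  have := ODE_solution_unique_univ (v := fun t => hillSystem q t) (s := fun _ => Set.univ)
    (t₀ := 0) (fun t => (hL t).lipschitzOnWith) (fun t => ⟨key hy t, Set.mem_univ _⟩)
    (fun t => ⟨key hz t, Set.mem_univ _⟩) (by simp [h0, h1])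
  funext t
  exact congrArg Prod.fst (congrFun this t)

theorem hill_reflect_mem (heven : ∀ t, q (-t) = q t) {y : ℝ → ℝ} (hy : y ∈ solutionSpace q) :
    (fun t => y (-t)) ∈ solutionSpace q := by
  have hd : deriv (fun t => y (-t)) = fun t => -deriv y (-t) := funext fun t => deriv_comp_neg y t
  refine ⟨hy.1.comp differentiable_neg, ?_, fun t => ?_⟩
  · rw [hd]
    exact (hy.2.1.comp differentiable_neg).neg
  · have h2 : deriv (fun t => -deriv y (-t)) t = deriv (deriv y) (-t) := by
      rw [deriv.fun_neg, deriv_comp_neg, neg_neg]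
    rw [hd, h2, ← heven t]
    exact hy.2.2 (-t)

theorem hill_wronskian_eq {y z : ℝ → ℝ} (hy : y ∈ solutionSpace q) (hz : z ∈ solutionSpace q)
    (t : ℝ) : y t * deriv z t - deriv y t * z t = y 0 * deriv z 0 - deriv y 0 * z 0 := by
  have hd (t : ℝ) : HasDerivAt (fun t => y t * deriv z t - deriv y t * z t) 0 t := by
    have h := ((hy.1 t).hasDerivAt.mul (hz.2.1 t).hasDerivAt).sub
      ((hy.2.1 t).hasDerivAt.mul (hz.1 t).hasDerivAt)
    convert! h using 1
    linear_combination z t * hy.2.2 t - y t * hz.2.2 t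
  exact is_const_of_deriv_eq_zero (fun t => (hd t).differentiableAt) (fun t => (hd t).deriv) t 0

/-- For an even coefficient of period `2 K`, the discriminant is expressed through the values at
`K` of the even and the odd normalized solution. -/
theorem hillDiscriminant_eq {M K : ℝ} (hM : ∀ t, |q t| ≤ M)
    (heven : ∀ t, q (-t) = q t) (hper : Function.Periodic q (2 * K)) {y z : ℝ → ℝ}
    (hy : y ∈ solutionSpace q) (hz : z ∈ solutionSpace q) (hy0 : y 0 = 1) (hy1 : deriv y 0 = 0)
    (hz0 : z 0 = 0) (hz1 : deriv z 0 = 1) :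
    hillDiscriminant q (2 * K) hper = 2 * (y K * deriv z K + deriv y K * z K) := by
  have hW := hill_wronskian_eq hy hz K
  have comb {w : ℝ → ℝ} (hw : w ∈ solutionSpace q) : w = w 0 • y + deriv w 0 • z := by
    refine hill_solution_ext hM hw (add_mem (Submodule.smul_mem _ _ hy)
      (Submodule.smul_mem _ _ hz)) (by simp [hy0, hz0]) ?_
    rw [deriv_add ((hy.1 0).const_smul _) ((hz.1 0).const_smul _), deriv_const_smul _ (hy.1 0),
      deriv_const_smul _ (hz.1 0)]
    simp [hy1, hz1]
  have hyr : (fun t => y (-t)) = y :=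
    hill_solution_ext hM (hill_reflect_mem heven hy) hy (by simp) (by simp [deriv_comp_neg, hy1])
  have hzr : (fun t => z (-t)) = -z := by
    refine hill_solution_ext hM (hill_reflect_mem heven hz) (neg_mem hz) (by simp [hz0]) ?_
    rw [deriv_comp_neg, deriv.neg]
    simp
  have hyd : deriv y (-K) = -deriv y K := by
    have := congrFun (congrArg deriv hyr) K
    rw [deriv_comp_neg] at this
    linarith
  have hzd : deriv z (-K) = deriv z K := by
    have := congrFun (congrArg deriv hzr) K
    rw [deriv_comp_neg, deriv.neg] at this
    linarith
  have hyK : y (-K) = y K := congrFun hyr K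
  have hzK : z (-K) = -z K := congrFun hzr K
  let u : solutionSpace q := ⟨y, hy⟩
  let v : solutionSpace q := ⟨z, hz⟩
  have hli : LinearIndependent ℝ ![u, v] := by
    rw [LinearIndependent.pair_iff]
    intro s t hst
    have e : s • y + t • z = 0 := congrArg Subtype.val hst
    have e0 := congrFun e 0
    have e1 := congrFun (congrArg deriv e) 0
    rw [deriv_add ((hy.1 0).const_smul _) ((hz.1 0).const_smul _), deriv_const_smul _ (hy.1 0),
      deriv_const_smul _ (hz.1 0)] at e1
    have : deriv (0 : ℝ → ℝ) 0 = 0 := by simp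
    rw [this] at e1
    simp [hy0, hz0] at e0
    simp [hy1, hz1] at e1
    exact ⟨e0, e1⟩
  have hsp : ⊤ ≤ Submodule.span ℝ (Set.range ![u, v]) := by
    rintro ⟨w, hw⟩ -
    rw [Matrix.range_cons, Matrix.range_cons, Matrix.range_empty, Set.union_empty,
      Set.singleton_union, Submodule.mem_span_pair]
    exact ⟨w 0, deriv w 0, Subtype.ext (comb hw).symm⟩
  let bs : Module.Basis (Fin 2) ℝ (solutionSpace q) := Module.Basis.mk hli hsp
  have hb0 : bs 0 = u := by simp [bs]
  have hb1 : bs 1 = v := by simp [bs]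
  have repr (w : solutionSpace q) (i : Fin 2) :
      bs.repr w i = ![(w : ℝ → ℝ) 0, deriv (w : ℝ → ℝ) 0] i := by
    have hw : w = (w : ℝ → ℝ) 0 • bs 0 + deriv (w : ℝ → ℝ) 0 • bs 1 := by
      rw [hb0, hb1]
      exact Subtype.ext (comb w.2)
    have h := congrArg (fun x => bs.repr x i) hw
    rw [h]
    fin_cases i <;> simp
  have tr : hillDiscriminant q (2 * K) hper = y (2 * K) + deriv z (2 * K) := by
    rw [hillDiscriminant, LinearMap.trace_eq_matrix_trace ℝ bs, Matrix.trace, Fin.sum_univ_two]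
    simp only [Matrix.diag_apply, LinearMap.toMatrix_apply, repr, hb0, hb1]
    have : deriv (fun t => z (t + 2 * K)) 0 = deriv z (2 * K) := by
      rw [deriv_comp_add_const, zero_add]
    simp [translation, u, v, this]
  -- Expand w(· + 2K) in the basis y, z and evaluate at -K, where parity is known. Applied to y and
  -- z, and combined with the Wronskian y z' - y' z = 1, this shows that both y(2K) and z'(2K) equal
  -- (y z' + y' z)(K).
  have shift {w : ℝ → ℝ} (hw : w ∈ solutionSpace q) :
      w K = w (2 * K) * y K - deriv w (2 * K) * z K ∧
      deriv w K = -w (2 * K) * deriv y K + deriv w (2 * K) * deriv z K := by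
    have h := comb (translate_mem hper hw)
    rw [deriv_comp_add_const] at h
    simp only [zero_add] at h
    constructor
    · have := congrFun h (-K)
      simp only [Pi.add_apply, Pi.smul_apply, smul_eq_mul, hyK, hzK] at this
      rw [show -K + 2 * K = K by ring] at this
      linarith
    · have := congrFun (congrArg deriv h) (-K)
      rw [deriv_comp_add_const, deriv_add ((hy.1 _).const_smul _) ((hz.1 _).const_smul _),
        deriv_const_smul _ (hy.1 _), deriv_const_smul _ (hz.1 _), hyd, hzd,
        show -K + 2 * K = K by ring] at this
      simp only [smul_eq_mul] at this
      linarith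
  obtain ⟨p1, p2⟩ := shift hy
  obtain ⟨r1, r2⟩ := shift hz
  rw [hy0, hy1, hz0, hz1] at hW
  rw [tr]
  linear_combination (-deriv z K) * p1 - z K * p2 - deriv y K * r1 - y K * r2
    - (y (2 * K) + deriv z (2 * K)) * hW

end Hill

theorem _root_.Real.hasDerivAt_tanh_one_sub_sq (t : ℝ) :
    HasDerivAt Real.tanh (1 - Real.tanh t ^ 2) t := by
  have hc := (Real.cosh_pos t).ne'
  have h := (Real.hasDerivAt_sinh t).div (Real.hasDerivAt_cosh t) hc
  have e : Real.tanh = Real.sinh / Real.cosh := funext Real.tanh_eq_sinh_div_cosh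
  rw [e]
  convert! h using 1
  simp only [Pi.div_apply]
  field_simp

theorem _root_.Real.tanh_nonneg {t : ℝ} (ht : 0 ≤ t) : 0 ≤ Real.tanh t := by
  rw [Real.tanh_eq_sinh_div_cosh]
  exact div_nonneg (Real.sinh_nonneg_iff.2 ht) (Real.cosh_pos t).le

/-! ### Jacobian elliptic functions: regularity, comparison with tanh, the integral of dn². -/

section Jacobi

variable {k : ℝ}

/-- The Jacobian elliptic function `dn`, as a function of the argument. -/
def jacobiDn (k t : ℝ) : ℝ :=
  √(1 - k ^ 2 * Real.sin (jacobiAm k t) ^ 2)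

theorem jacobiDn_pos (hk : k ∈ Set.Ioo (0 : ℝ) 1) (t : ℝ) : 0 < jacobiDn k t :=
  Real.sqrt_pos.2 (one_sub_pos hk _)

theorem jacobiDn_sq (hk : k ∈ Set.Ioo (0 : ℝ) 1) (t : ℝ) :
    jacobiDn k t ^ 2 = 1 - k ^ 2 * jacobiSn t k ^ 2 :=
  Real.sq_sqrt (one_sub_pos hk _).le

theorem ellipticF_strictMono (hk : k ∈ Set.Ioo (0 : ℝ) 1) : StrictMono (ellipticF k) :=
  fun a b hab => by linarith [ellipticF_sub_ge hk hab.le]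

theorem jacobiAm_ellipticF (hk : k ∈ Set.Ioo (0 : ℝ) 1) (φ : ℝ) :
    jacobiAm k (ellipticF k φ) = φ :=
  Function.leftInverse_invFun (ellipticF_bijective hk).1 φ

theorem jacobiAm_monotone (hk : k ∈ Set.Ioo (0 : ℝ) 1) : Monotone (jacobiAm k) := by
  intro s t hst
  rw [← (ellipticF_strictMono hk).le_iff_le, ellipticF_jacobiAm hk, ellipticF_jacobiAm hk]
  exact hst

/-- The integrand of F is at least 1, so F expands distances and its inverse is 1-Lipschitz. -/
theorem continuous_jacobiAm (hk : k ∈ Set.Ioo (0 : ℝ) 1) : Continuous (jacobiAm k) := by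
  refine (LipschitzWith.of_dist_le_mul (K := 1) fun s t => ?_).continuous
  wlog hst : s ≤ t generalizing s t
  · rw [dist_comm, dist_comm s]
    exact this t s (le_of_not_ge hst)
  have h := ellipticF_sub_ge hk (jacobiAm_monotone hk hst)
  rw [ellipticF_jacobiAm hk, ellipticF_jacobiAm hk] at h
  rw [dist_comm, dist_comm s, Real.dist_eq, Real.dist_eq,
    abs_of_nonneg (sub_nonneg.2 (jacobiAm_monotone hk hst)), abs_of_nonneg (sub_nonneg.2 hst)]
  simpa using h

theorem hasDerivAt_jacobiAm (hk : k ∈ Set.Ioo (0 : ℝ) 1) (t : ℝ) :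
    HasDerivAt (jacobiAm k) (jacobiDn k t) t := by
  have hF : HasDerivAt (ellipticF k) (1 / jacobiDn k t) (jacobiAm k t) :=
    ((continuous_integrand hk).integral_hasStrictDerivAt 0 _).hasDerivAt
  have h := hF.of_local_left_inverse (continuous_jacobiAm hk).continuousAt
    (one_div_pos.2 (jacobiDn_pos hk t)).ne' (.of_forall fun s => ellipticF_jacobiAm hk s)
  simpa using h

theorem jacobiAm_zero (hk : k ∈ Set.Ioo (0 : ℝ) 1) : jacobiAm k 0 = 0 := by
  have := jacobiAm_ellipticF hk 0
  rwa [ellipticF_zero] at this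

theorem jacobiAm_ellipticK (hk : k ∈ Set.Ioo (0 : ℝ) 1) :
    jacobiAm k (ellipticK k) = Real.pi / 2 := by
  rw [← ellipticF_pi_div_two hk, jacobiAm_ellipticF hk]

theorem ellipticK_pos (hk : k ∈ Set.Ioo (0 : ℝ) 1) : 0 < ellipticK k := by
  rw [← ellipticF_pi_div_two hk, ← ellipticF_zero k]
  exact ellipticF_strictMono hk (by positivity)

theorem jacobiAm_neg (hk : k ∈ Set.Ioo (0 : ℝ) 1) (t : ℝ) : jacobiAm k (-t) = -jacobiAm k t := by
  have hF (φ : ℝ) : ellipticF k (-φ) = -ellipticF k φ := by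
    have h := intervalIntegral.integral_comp_neg (a := 0) (b := φ)
      (fun θ : ℝ => 1 / √(1 - k ^ 2 * Real.sin θ ^ 2))
    simp only [Real.sin_neg, neg_sq, neg_zero] at h
    rw [ellipticF, ellipticF, h, intervalIntegral.integral_symm]
  apply (ellipticF_bijective hk).1
  rw [hF, ellipticF_jacobiAm hk, ellipticF_jacobiAm hk]

theorem hasDerivAt_jacobiSn (hk : k ∈ Set.Ioo (0 : ℝ) 1) (t : ℝ) :
    HasDerivAt (fun t => jacobiSn t k) (Real.cos (jacobiAm k t) * jacobiDn k t) t :=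
  (hasDerivAt_jacobiAm hk t).sin

theorem jacobiSn_nonneg (hk : k ∈ Set.Ioo (0 : ℝ) 1) {t : ℝ} (h0 : 0 ≤ t)
    (hK : t ≤ ellipticK k) : 0 ≤ jacobiSn t k := by
  have h1 := jacobiAm_monotone hk h0
  have h2 := jacobiAm_monotone hk hK
  rw [jacobiAm_zero hk] at h1
  rw [jacobiAm_ellipticK hk] at h2
  exact Real.sin_nonneg_of_nonneg_of_le_pi h1 (by linarith [Real.pi_pos])

theorem cos_jacobiAm_nonneg (hk : k ∈ Set.Ioo (0 : ℝ) 1) {t : ℝ} (h0 : 0 ≤ t)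
    (hK : t ≤ ellipticK k) : 0 ≤ Real.cos (jacobiAm k t) := by
  have h1 := jacobiAm_monotone hk h0
  have h2 := jacobiAm_monotone hk hK
  rw [jacobiAm_zero hk] at h1
  rw [jacobiAm_ellipticK hk] at h2
  exact Real.cos_nonneg_of_neg_pi_div_two_le_of_le (by linarith [Real.pi_pos]) h2

/-- The function artanh(k sn), written below with logarithms, vanishes at 0 and has derivative k cn
/ dn. This is at most 1 because k² cn² = k² - k² sn² ≤ 1 - k² sn² = dn². -/
theorem mul_jacobiSn_le_tanh (hk : k ∈ Set.Ioo (0 : ℝ) 1) {t : ℝ} (ht : 0 ≤ t) :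
    k * jacobiSn t k ≤ Real.tanh t := by
  have hlt (t : ℝ) : |k * jacobiSn t k| < 1 := by
    rw [← sq_lt_one_iff_abs_lt_one]
    have := one_sub_pos hk (jacobiAm k t)
    simp only [jacobiSn, mul_pow]
    linarith
  have hmem (t : ℝ) : k * jacobiSn t k ∈ Set.Ioo (-1 : ℝ) 1 := abs_lt.1 (hlt t)
  have hd (t : ℝ) : HasDerivAt
      (fun t => 1 / 2 * (Real.log (1 + k * jacobiSn t k) - Real.log (1 - k * jacobiSn t k)) - t)
      (k * Real.cos (jacobiAm k t) / jacobiDn k t - 1) t := by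
    have h1 := (hasDerivAt_jacobiSn hk t).const_mul k
    have p1 : 1 + k * jacobiSn t k ≠ 0 := by linarith [(hmem t).1]
    have p2 : 1 - k * jacobiSn t k ≠ 0 := by linarith [(hmem t).2]
    have h := ((((h1.const_add 1).log p1).sub ((h1.const_sub 1).log p2)).const_mul
      (1 / 2)).sub (hasDerivAt_id t)
    convert! h using 1
    have hdn := (jacobiDn_pos hk t).ne'
    have h2 := jacobiDn_sq hk t
    rw [div_sub_div _ _ p1 p2]
    have p3 : (1 + k * jacobiSn t k) * (1 - k * jacobiSn t k) = jacobiDn k t ^ 2 := by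
      rw [h2]; ring
    rw [p3]
    field_simp
    ring
  have hanti := antitone_of_hasDerivAt_nonpos hd fun t => by
    have hdn := jacobiDn_pos hk t
    have : k * Real.cos (jacobiAm k t) ≤ jacobiDn k t := by
      refine Real.le_sqrt_of_sq_le ?_
      have : k ^ 2 < 1 := by nlinarith [hk.1, hk.2]
      rw [mul_pow, Real.cos_sq']
      linarith
    simpa using (div_le_one hdn).2 this
  have h := hanti ht
  simp only [jacobiSn, jacobiAm_zero hk, Real.sin_zero, mul_zero, add_zero, Real.log_one, sub_self,
    sub_zero, sub_nonpos] at h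
  have hm := hmem t
  rw [← Real.artanh_le_artanh_iff hm ⟨Real.neg_one_lt_tanh t, Real.tanh_lt_one t⟩,
    Real.artanh_tanh, Real.artanh_eq_half_log ⟨hm.1.le, hm.2.le⟩,
    Real.log_div (by linarith [hm.1]) (by linarith [hm.2])]
  exact h

/-- Jacobi's epsilon function `∫₀ᵗ dn²`, in terms of the amplitude. -/
def jacobiEpsilon (k t : ℝ) : ℝ :=
  ∫ θ in (0 : ℝ)..jacobiAm k t, √(1 - k ^ 2 * Real.sin θ ^ 2)

theorem hasDerivAt_jacobiEpsilon (hk : k ∈ Set.Ioo (0 : ℝ) 1) (t : ℝ) :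
    HasDerivAt (jacobiEpsilon k) (1 - k ^ 2 * jacobiSn t k ^ 2) t := by
  have hc : Continuous fun θ : ℝ => √(1 - k ^ 2 * Real.sin θ ^ 2) := by fun_prop
  have h := (hc.integral_hasStrictDerivAt 0 (jacobiAm k t)).hasDerivAt.comp t
    (hasDerivAt_jacobiAm hk t)
  rw [← jacobiDn_sq hk, sq]
  exact h

theorem jacobiEpsilon_zero (hk : k ∈ Set.Ioo (0 : ℝ) 1) : jacobiEpsilon k 0 = 0 := by
  simp [jacobiEpsilon, jacobiAm_zero hk]

/-- The substitution t = sin θ, done on open intervals because the integrand in t is singular at 1.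
-/
theorem jacobiEpsilon_ellipticK (hk : k ∈ Set.Ioo (0 : ℝ) 1) :
    jacobiEpsilon k (ellipticK k) = ellipticE k := by
  have hpi := Real.pi_pos
  have himg : Real.sin '' Set.Ioo 0 (Real.pi / 2) = Set.Ioo (0 : ℝ) 1 := by
    ext x
    constructor
    · rintro ⟨θ, hθ, rfl⟩
      refine ⟨Real.sin_pos_of_pos_of_lt_pi hθ.1 (by linarith [hθ.2]), ?_⟩
      have := Real.strictMonoOn_sin (a := θ) (b := Real.pi / 2)
        ⟨by linarith [hθ.1], hθ.2.le⟩ ⟨by linarith, le_rfl⟩ hθ.2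
      simpa using this
    · intro hx
      exact ⟨Real.arcsin x, ⟨Real.arcsin_pos.2 hx.1, Real.arcsin_lt_pi_div_two.2 hx.2⟩,
        Real.sin_arcsin (by linarith [hx.1]) hx.2.le⟩
  have hinj : Set.InjOn Real.sin (Set.Ioo 0 (Real.pi / 2)) :=
    Real.strictMonoOn_sin.injOn.mono fun θ hθ =>
      Set.mem_Icc.2 ⟨by linarith [hθ.1], hθ.2.le⟩
  have key := integral_image_eq_integral_abs_deriv_smul
    (s := Set.Ioo 0 (Real.pi / 2)) (f := Real.sin) (f' := Real.cos) measurableSet_Ioo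
    (fun θ _ => (Real.hasDerivAt_sin θ).hasDerivWithinAt) hinj
    (fun t => √(1 - k ^ 2 * t ^ 2) / √(1 - t ^ 2))
  rw [himg] at key
  rw [jacobiEpsilon, jacobiAm_ellipticK hk, ellipticE, intervalIntegral.integral_of_le (by linarith),
    intervalIntegral.integral_of_le zero_le_one, integral_Ioc_eq_integral_Ioo,
    integral_Ioc_eq_integral_Ioo, key]
  refine setIntegral_congr_fun measurableSet_Ioo fun θ hθ => ?_
  have hcos : 0 < Real.cos θ := Real.cos_pos_of_mem_Ioo ⟨by linarith [hθ.1], hθ.2⟩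
  have h1 : √(1 - Real.sin θ ^ 2) = Real.cos θ := by
    rw [← Real.cos_sq', Real.sqrt_sq hcos.le]
  simp only [h1, abs_of_pos hcos, smul_eq_mul]
  field_simp

end Jacobi

/-! ### The Lamé coefficient and its limit. -/

section Coefficient

variable {h ν k : ℝ}

theorem hasDerivAt_lameCoeff (hk : k ∈ Set.Ioo (0 : ℝ) 1) (t : ℝ) :
    HasDerivAt (lameCoeff h ν k)
      (-(ν * (ν + 1)) * (2 * k ^ 2 * (jacobiSn t k * Real.cos (jacobiAm k t) * jacobiDn k t))) t := by
  have := (((hasDerivAt_jacobiSn hk t).pow 2).const_mul (ν * (ν + 1) * k ^ 2)).const_sub h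
  convert! this using 1
  push_cast
  ring

theorem continuous_lameCoeff (hk : k ∈ Set.Ioo (0 : ℝ) 1) : Continuous (lameCoeff h ν k) :=
  continuous_iff_continuousAt.2 fun t => (hasDerivAt_lameCoeff hk t).continuousAt

theorem sq_mul_jacobiSn_sq_le (hk : k ∈ Set.Ioo (0 : ℝ) 1) (t : ℝ) :
    k ^ 2 * jacobiSn t k ^ 2 ≤ 1 :=
  (sub_pos.1 (one_sub_pos hk (jacobiAm k t))).le

theorem abs_lameCoeff_le (hk : k ∈ Set.Ioo (0 : ℝ) 1) (t : ℝ) :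
    |lameCoeff h ν k t| ≤ |h| + |ν * (ν + 1)| := by
  have h1 := sq_mul_jacobiSn_sq_le hk t
  have h2 : 0 ≤ k ^ 2 * jacobiSn t k ^ 2 := by positivity
  rw [lameCoeff, mul_assoc (ν * (ν + 1))]
  refine (abs_sub _ _).trans ?_
  rw [abs_mul (ν * (ν + 1)), abs_of_nonneg h2]
  nlinarith [abs_nonneg (ν * (ν + 1))]

theorem lameCoeff_neg (hk : k ∈ Set.Ioo (0 : ℝ) 1) (t : ℝ) :
    lameCoeff h ν k (-t) = lameCoeff h ν k t := by
  simp [lameCoeff, jacobiSn, jacobiAm_neg hk]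

theorem lameCoeff_zero (hk : k ∈ Set.Ioo (0 : ℝ) 1) : lameCoeff h ν k 0 = h := by
  simp [lameCoeff, jacobiSn, jacobiAm_zero hk]

/-- The coefficient `h - ν (ν + 1) tanh² t` of the limiting equation for `k → 1`. -/
def limitCoeff (h ν t : ℝ) : ℝ :=
  h - ν * (ν + 1) * Real.tanh t ^ 2

theorem hasDerivAt_limitCoeff (t : ℝ) :
    HasDerivAt (limitCoeff h ν)
      (-(ν * (ν + 1)) * (2 * (Real.tanh t * (1 - Real.tanh t ^ 2)))) t := by
  have := (((Real.hasDerivAt_tanh_one_sub_sq t).pow 2).const_mul (ν * (ν + 1))).const_sub h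
  convert! this using 1
  push_cast
  ring

end Coefficient

/-! ### Energy estimates for inhomogeneous equations. -/

section Energy

/-- Formally (√e)' ≤ g. Since e may vanish, in particular at 0 in the comparison argument, √(e + δ²)
is used instead and δ tends to 0. -/
theorem sqrt_le_add_sub_of_deriv_le {e e' G g : ℝ → ℝ} {T : ℝ} (hT : 0 ≤ T)
    (he : ∀ t ∈ Set.Icc 0 T, HasDerivAt e (e' t) t) (hG : ∀ t ∈ Set.Icc 0 T, HasDerivAt G (g t) t)
    (he0 : ∀ t ∈ Set.Icc 0 T, 0 ≤ e t) (hg0 : ∀ t ∈ Set.Icc 0 T, 0 ≤ g t)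
    (h : ∀ t ∈ Set.Icc 0 T, e' t ≤ 2 * √(e t) * g t) : √(e T) ≤ √(e 0) + (G T - G 0) := by
  refine le_of_forall_pos_le_add fun δ hδ => ?_
  have hpos : ∀ t ∈ Set.Icc 0 T, 0 < e t + δ ^ 2 := fun t ht => by
    have := he0 t ht
    positivity
  have hd : ∀ t ∈ Set.Icc 0 T, HasDerivAt (fun t => √(e t + δ ^ 2) - G t)
      (e' t / (2 * √(e t + δ ^ 2)) - g t) t := fun t ht =>
    (((he t ht).add_const _).sqrt (hpos t ht).ne').sub (hG t ht)
  have hanti : AntitoneOn (fun t => √(e t + δ ^ 2) - G t) (Set.Icc 0 T) := by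
    refine antitoneOn_of_hasDerivWithinAt_nonpos (convex_Icc 0 T)
      (fun t ht => (hd t ht).continuousAt.continuousWithinAt)
      (fun t ht => (hd t (interior_subset ht)).hasDerivWithinAt) fun t ht => ?_
    have ht := interior_subset ht
    have hs := Real.sqrt_pos.2 (hpos t ht)
    rw [sub_nonpos, div_le_iff₀ (by positivity)]
    have : √(e t) ≤ √(e t + δ ^ 2) := Real.sqrt_le_sqrt (by nlinarith)
    nlinarith [h t ht, hg0 t ht]
  have h1 := hanti ⟨le_rfl, hT⟩ ⟨hT, le_rfl⟩ hT
  have h2 : √(e 0 + δ ^ 2) ≤ √(e 0) + δ := by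
    rw [Real.sqrt_le_left (by positivity)]
    nlinarith [Real.sq_sqrt (he0 0 ⟨le_rfl, hT⟩), Real.sqrt_nonneg (e 0)]
  have h3 : √(e T) ≤ √(e T + δ ^ 2) := Real.sqrt_le_sqrt (by nlinarith)
  simp only at h1
  linarith

variable {z z' Q Q' r G g : ℝ → ℝ} {T : ℝ}

/-- Energy estimate for `z'' + Q z = r` with a decreasing coefficient `Q`. -/
theorem sqrt_energy_le_of_deriv_nonpos (hT : 0 ≤ T)
    (hz : ∀ t ∈ Set.Icc 0 T, HasDerivAt z (z' t) t)
    (hz' : ∀ t ∈ Set.Icc 0 T, HasDerivAt z' (r t - Q t * z t) t)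
    (hQ : ∀ t ∈ Set.Icc 0 T, HasDerivAt Q (Q' t) t) (hG : ∀ t ∈ Set.Icc 0 T, HasDerivAt G (g t) t)
    (hQ0 : ∀ t ∈ Set.Icc 0 T, 0 ≤ Q t) (hQ'0 : ∀ t ∈ Set.Icc 0 T, Q' t ≤ 0)
    (hr : ∀ t ∈ Set.Icc 0 T, |r t| ≤ g t) :
    √(z' T ^ 2 + Q T * z T ^ 2) ≤ √(z' 0 ^ 2 + Q 0 * z 0 ^ 2) + (G T - G 0) := by
  -- In the derivative of z'² + Q z² the terms 2 Q z z' cancel, and Q' z² has the favourable sign.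
  refine sqrt_le_add_sub_of_deriv_le (e := fun t => z' t ^ 2 + Q t * z t ^ 2)
    (e' := fun t => Q' t * z t ^ 2 + 2 * z' t * r t) hT (fun t ht => ?_) hG (fun t ht => ?_)
    (fun t ht => (abs_nonneg _).trans (hr t ht)) fun t ht => ?_
  · convert! ((hz' t ht).pow 2).add ((hQ t ht).mul ((hz t ht).pow 2)) using 1
    push_cast
    simp only [Pi.pow_apply]
    ring
  · have := hQ0 t ht
    positivity
  · have h1 : Q' t * z t ^ 2 ≤ 0 := mul_nonpos_of_nonpos_of_nonneg (hQ'0 t ht) (sq_nonneg _)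
    have h2 : |z' t| ≤ √(z' t ^ 2 + Q t * z t ^ 2) := by
      refine Real.abs_le_sqrt ?_
      have := mul_nonneg (hQ0 t ht) (sq_nonneg (z t))
      linarith
    have h3 : z' t * r t ≤ √(z' t ^ 2 + Q t * z t ^ 2) * g t := by
      refine (le_abs_self _).trans ?_
      rw [abs_mul]
      exact mul_le_mul h2 (hr t ht) (abs_nonneg _) (Real.sqrt_nonneg _)
    linarith

/-- Energy estimate for `z'' + Q z = r` with an increasing coefficient `Q`. -/
theorem sqrt_energy_le_of_deriv_nonneg {m : ℝ} (hm : 0 < m) (hT : 0 ≤ T)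
    (hz : ∀ t ∈ Set.Icc 0 T, HasDerivAt z (z' t) t)
    (hz' : ∀ t ∈ Set.Icc 0 T, HasDerivAt z' (r t - Q t * z t) t)
    (hQ : ∀ t ∈ Set.Icc 0 T, HasDerivAt Q (Q' t) t) (hG : ∀ t ∈ Set.Icc 0 T, HasDerivAt G (g t) t)
    (hQ0 : ∀ t ∈ Set.Icc 0 T, m ≤ Q t) (hQ'0 : ∀ t ∈ Set.Icc 0 T, 0 ≤ Q' t)
    (hr : ∀ t ∈ Set.Icc 0 T, |r t| ≤ √m * g t) :
    √(z T ^ 2 + z' T ^ 2 / Q T) ≤ √(z 0 ^ 2 + z' 0 ^ 2 / Q 0) + (G T - G 0) := by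
  have hg : ∀ t ∈ Set.Icc 0 T, 0 ≤ g t := fun t ht =>
    nonneg_of_mul_nonneg_right ((abs_nonneg _).trans (hr t ht)) (Real.sqrt_pos.2 hm)
  -- For increasing Q the energy is divided by Q, so that Q' enters as -Q' z'²/Q². The source is
  -- then divided by √Q ≥ √m, which explains the factor √m in the hypothesis on r.
  refine sqrt_le_add_sub_of_deriv_le (e := fun t => z t ^ 2 + z' t ^ 2 / Q t)
    (e' := fun t => 2 * (z' t * r t / Q t) - Q' t * z' t ^ 2 / Q t ^ 2) hT
    (fun t ht => ?_) hG (fun t ht => ?_) hg fun t ht => ?_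
  · have hp : Q t ≠ 0 := (hm.trans_le (hQ0 t ht)).ne'
    convert! ((hz t ht).pow 2).add (((hz' t ht).pow 2).div (hQ t ht) hp) using 1
    push_cast
    simp only [Pi.pow_apply]
    field_simp
    ring
  · have := hm.trans_le (hQ0 t ht)
    positivity
  · have hp : 0 < Q t := hm.trans_le (hQ0 t ht)
    have h1 : 0 ≤ Q' t * z' t ^ 2 / Q t ^ 2 := by
      have := hQ'0 t ht
      positivity
    have hsq : 0 < √(Q t) := Real.sqrt_pos.2 hp
    have h2 : |z' t| / √(Q t) ≤ √(z t ^ 2 + z' t ^ 2 / Q t) := by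
      refine Real.le_sqrt_of_sq_le ?_
      rw [div_pow, sq_abs, Real.sq_sqrt hp.le]
      linarith [sq_nonneg (z t)]
    have h4 : |r t| / √(Q t) ≤ g t := by
      rw [div_le_iff₀ hsq, mul_comm]
      exact (hr t ht).trans (mul_le_mul_of_nonneg_right (Real.sqrt_le_sqrt (hQ0 t ht)) (hg t ht))
    have h3 : z' t * r t / Q t ≤ √(z t ^ 2 + z' t ^ 2 / Q t) * g t := by
      refine (le_abs_self _).trans ?_
      calc |z' t * r t / Q t| = |z' t| / √(Q t) * (|r t| / √(Q t)) := by
            rw [abs_div, abs_mul, abs_of_pos hp, div_mul_div_comm, Real.mul_self_sqrt hp.le]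
        _ ≤ _ := mul_le_mul h2 h4 (by positivity) (Real.sqrt_nonneg _)
    linarith

end Energy

/-! ### Complex amplitudes relative to e^{iωt}. -/

section Amplitude

variable {ω : ℝ}

/-- The complex amplitude `α` for which `y = Re (α e^{iωt})` and `y' = Re (iω α e^{iωt})` at `t`. -/
def amplitude (ω : ℝ) (y : ℝ → ℝ) (t : ℝ) : ℂ :=
  Complex.exp (-(Complex.I * ω * t)) * (deriv y t + Complex.I * ω * y t) / (Complex.I * ω)

theorem norm_amplitude (hω : 0 < ω) (y : ℝ → ℝ) (t : ℝ) :
    ‖amplitude ω y t‖ = √(deriv y t ^ 2 + ω ^ 2 * y t ^ 2) / ω := by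
  have h1 : ‖Complex.exp (-(Complex.I * ω * t))‖ = 1 := by
    rw [Complex.norm_exp]
    simp
  have h2 : ‖(deriv y t + Complex.I * ω * y t : ℂ)‖ = √(deriv y t ^ 2 + ω ^ 2 * y t ^ 2) := by
    have : (deriv y t + Complex.I * ω * y t : ℂ) = deriv y t + (ω * y t : ℝ) * Complex.I := by
      push_cast; ring
    rw [this, Complex.norm_add_mul_I, mul_pow]
  rw [amplitude, norm_div, norm_mul, h1, h2, norm_mul, Complex.norm_I, Complex.norm_real,
    Real.norm_of_nonneg hω.le, one_mul, one_mul]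

/-- The form adapted to the energy z² + z'²/Q, as `norm_amplitude` is to z'² + Q z². -/
theorem norm_amplitude' (hω : 0 < ω) (y : ℝ → ℝ) (t : ℝ) :
    ‖amplitude ω y t‖ = √(y t ^ 2 + deriv y t ^ 2 / ω ^ 2) := by
  rw [norm_amplitude hω, eq_comm, Real.sqrt_eq_iff_mul_self_eq (by positivity) (by positivity),
    div_mul_div_comm, Real.mul_self_sqrt (by positivity)]
  field_simp
  ring

theorem abs_le_norm_amplitude (hω : 0 < ω) (y : ℝ → ℝ) (t : ℝ) : |y t| ≤ ‖amplitude ω y t‖ := by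
  rw [norm_amplitude' hω]
  refine Real.abs_le_sqrt ?_
  have : 0 ≤ deriv y t ^ 2 / ω ^ 2 := by positivity
  linarith

theorem amplitude_sub {y v : ℝ → ℝ} {t : ℝ} (hy : DifferentiableAt ℝ y t)
    (hv : DifferentiableAt ℝ v t) :
    amplitude ω (y - v) t = amplitude ω y t - amplitude ω v t := by
  rw [amplitude, deriv_sub hy hv, amplitude, amplitude, Pi.sub_apply]
  push_cast
  ring

/-- Variation of constants: the amplitude would be constant for q = ω², so its derivative contains
only the defect ω² - q. -/
theorem hasDerivAt_amplitude (hω : 0 < ω) {q y : ℝ → ℝ} (hy : y ∈ solutionSpace q) (t : ℝ) :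
    HasDerivAt (amplitude ω y)
      (Complex.exp (-(Complex.I * ω * t)) * ((ω ^ 2 - q t) * y t) / (Complex.I * ω)) t := by
  have h1 := (hy.1 t).hasDerivAt.ofReal_comp
  have h2 := (hy.2.1 t).hasDerivAt.ofReal_comp
  have h3 : HasDerivAt (fun t : ℝ => Complex.exp (-(Complex.I * ω * t)))
      (Complex.exp (-(Complex.I * ω * t)) * -(Complex.I * ω * 1)) t :=
    ((Complex.ofRealCLM.hasDerivAt (x := t)).const_mul (Complex.I * ω)).neg.cexp
  have h := (h3.mul (h2.add (h1.const_mul (Complex.I * ω)))).div_const (Complex.I * ω)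
  have hw : (Complex.I * ω : ℂ) ≠ 0 := by simp [hω.ne']
  convert! h using 1
  have e : deriv (deriv y) t = -(q t) * y t := by linear_combination hy.2.2 t
  simp only [Pi.add_apply, e]
  push_cast
  congr 1
  linear_combination (Complex.exp (-(Complex.I * ω * t)) * ω ^ 2 * y t) * Complex.I_sq

/-- Integrate the derivative of the amplitude from K to T, with tanh as primitive of 1 - tanh², and
let T → ∞. -/
theorem norm_amplitude_sub_le {q v : ℝ → ℝ} {C L K : ℝ} {a : ℂ} (hω : 0 < ω)
    (hv : v ∈ solutionSpace q) (hL : 0 ≤ L)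
    (hq : ∀ t, |ω ^ 2 - q t| ≤ L * (1 - Real.tanh t ^ 2)) (hC : ∀ t, K ≤ t → |v t| ≤ C)
    (ha : Tendsto (amplitude ω v) atTop (𝓝 a)) :
    ‖amplitude ω v K - a‖ ≤ C * (L / ω * (1 - Real.tanh K)) := by
  have hC0 : 0 ≤ C := (abs_nonneg _).trans (hC K le_rfl)
  have main (T : ℝ) (hT : K ≤ T) :
      ‖amplitude ω v K - amplitude ω v T‖ ≤ C * (L / ω * (1 - Real.tanh K)) := by
    rw [norm_sub_rev]
    have h := image_norm_le_of_norm_deriv_right_le_deriv_boundary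
      (f := fun t => amplitude ω v t - amplitude ω v K) (a := K) (b := T)
      (B := fun t => C * (L / ω * (Real.tanh t - Real.tanh K)))
      (B' := fun t => C * (L / ω * (1 - Real.tanh t ^ 2)))
      (fun t _ => ((hasDerivAt_amplitude hω hv t).sub_const _).continuousAt.continuousWithinAt)
      (fun t _ => ((hasDerivAt_amplitude hω hv t).sub_const _).hasDerivWithinAt) (by simp)
      (fun t => (((Real.hasDerivAt_tanh_one_sub_sq t).sub_const _).const_mul _).const_mul _)
      (fun t ht => ?_) ⟨hT, le_rfl⟩
    · refine h.trans ?_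
      have := (Real.tanh_lt_one T).le
      gcongr
    · have h1 : ‖Complex.exp (-(Complex.I * ω * t))‖ = 1 := by
        rw [Complex.norm_exp]
        simp
      have h2 : ‖((ω ^ 2 - q t) * v t : ℂ)‖ = |ω ^ 2 - q t| * |v t| := by
        rw [← abs_mul, ← Real.norm_eq_abs, ← Complex.norm_real]
        push_cast
        rfl
      rw [norm_div, norm_mul, h1, h2, norm_mul, Complex.norm_I, Complex.norm_real,
        Real.norm_of_nonneg hω.le, one_mul, one_mul]
      calc |ω ^ 2 - q t| * |v t| / ω ≤ L * (1 - Real.tanh t ^ 2) * C / ω := by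
            have := mul_le_mul (hq t) (hC t ht.1) (abs_nonneg _)
              ((abs_nonneg _).trans (hq t))
            gcongr
        _ = _ := by ring
  exact le_of_tendsto (tendsto_const_nhds.sub ha).norm
    ((eventually_ge_atTop K).mono fun T hT => main T hT)

end Amplitude

/-! ### Comparison of the Lamé equation with the limiting equation. -/

section Comparison

variable {h ν k : ℝ}

theorem limitCoeff_sub_lameCoeff (t : ℝ) : limitCoeff h ν t - lameCoeff h ν k t =
    -(ν * (ν + 1)) * (Real.tanh t ^ 2 - k ^ 2 * jacobiSn t k ^ 2) := by
  simp only [limitCoeff, lameCoeff]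
  ring

theorem hasDerivAt_of_mem_solutionSpace {q y : ℝ → ℝ} (hy : y ∈ solutionSpace q) (t : ℝ) :
    HasDerivAt (deriv y) (0 - q t * y t) t := by
  have e : deriv (deriv y) t = 0 - (q t) * y t := by linear_combination hy.2.2 t
  rw [← e]
  exact (hy.2.1 t).hasDerivAt

/-- The difference is treated as a solution of the equation of y, with a source that contains only
v; thus an a priori bound for v suffices. -/
theorem hasDerivAt_deriv_sub {q p y v : ℝ → ℝ} (hy : y ∈ solutionSpace q)
    (hv : v ∈ solutionSpace p) (t : ℝ) :
    HasDerivAt (deriv (y - v)) ((p t - q t) * v t - q t * (y - v) t) t := by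
  have e : deriv (y - v) = deriv y - deriv v := funext fun t => deriv_sub (hy.1 t) (hv.1 t)
  rw [e]
  convert! (hasDerivAt_of_mem_solutionSpace hy t).sub (hasDerivAt_of_mem_solutionSpace hv t) using 1
  simp only [Pi.sub_apply]
  ring

/-- The last factor is tanh² - k² sn², arranged as the derivative of `jacobiEpsilon k t - tanh t`.
-/
theorem abs_coeff_diff_mul_le (hk : k ∈ Set.Ioo (0 : ℝ) 1) {t x C : ℝ} (h0 : 0 ≤ t)
    (hK : t ≤ ellipticK k) (hx : |x| ≤ C) :
    |(limitCoeff h ν t - lameCoeff h ν k t) * x| ≤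
      |ν * (ν + 1)| * C * (1 - k ^ 2 * jacobiSn t k ^ 2 - (1 - Real.tanh t ^ 2)) := by
  have h1 : 0 ≤ Real.tanh t ^ 2 - k ^ 2 * jacobiSn t k ^ 2 := by
    rw [sub_nonneg, ← mul_pow]
    have := mul_nonneg hk.1.le (jacobiSn_nonneg hk h0 hK)
    exact pow_le_pow_left₀ this (mul_jacobiSn_le_tanh hk h0) 2
  rw [limitCoeff_sub_lameCoeff, abs_mul, abs_mul, abs_neg, abs_of_nonneg h1]
  calc |ν * (ν + 1)| * (Real.tanh t ^ 2 - k ^ 2 * jacobiSn t k ^ 2) * |x|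
      ≤ |ν * (ν + 1)| * (Real.tanh t ^ 2 - k ^ 2 * jacobiSn t k ^ 2) * C := by gcongr
    _ = _ := by ring

theorem lameOmega_sq (hω : ν * (ν + 1) < h) : lameOmega h ν ^ 2 = h - ν * (ν + 1) :=
  Real.sq_sqrt (by linarith)

theorem lameOmega_pos (hω : ν * (ν + 1) < h) : 0 < lameOmega h ν :=
  Real.sqrt_pos.2 (by linarith)

/-- Triangle inequality through the amplitude of v at K: the difference y - v contributes E - tanh K
and the tail of v contributes 1 - tanh K. The constant c absorbs the factor 1/ω of the tail; it is
1/ω in one case and 1/√h in the other. -/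
theorem norm_amplitude_sub_le_of_bounds (hω : ν * (ν + 1) < h) (hk : k ∈ Set.Ioo (0 : ℝ) 1)
    {y v : ℝ → ℝ} {a : ℂ} {A c : ℝ} (hy : y ∈ solutionSpace (lameCoeff h ν k))
    (hv : v ∈ solutionSpace (limitCoeff h ν)) (ha : Tendsto (amplitude (lameOmega h ν) v) atTop (𝓝 a))
    (hA : ∀ t, 0 ≤ t → ‖amplitude (lameOmega h ν) v t‖ ≤ A) (hc : 1 / lameOmega h ν ≤ c)
    (hd : ‖amplitude (lameOmega h ν) (y - v) (ellipticK k)‖ ≤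
      A * (|ν * (ν + 1)| * c * (ellipticE k - Real.tanh (ellipticK k)))) :
    ‖a‖ ≤ A ∧ ‖amplitude (lameOmega h ν) y (ellipticK k) - a‖ ≤
      A * (|ν * (ν + 1)| * c * (ellipticE k + 1 - 2 * Real.tanh (ellipticK k))) := by
  have hω0 := lameOmega_pos hω
  have hA0 : 0 ≤ A := (norm_nonneg _).trans (hA 0 le_rfl)
  refine ⟨le_of_tendsto ha.norm ((eventually_ge_atTop 0).mono hA), ?_⟩
  have tail := norm_amplitude_sub_le (K := ellipticK k) (C := A) (L := |ν * (ν + 1)|) hω0 hv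
    (abs_nonneg _) (fun t => ?_) (fun t ht => (abs_le_norm_amplitude hω0 v t).trans
      (hA t ((ellipticK_pos hk).le.trans ht))) ha
  · rw [amplitude_sub (hy.1 _) (hv.1 _)] at hd
    have h1 := norm_sub_le_norm_sub_add_norm_sub (amplitude (lameOmega h ν) y (ellipticK k))
      (amplitude (lameOmega h ν) v (ellipticK k)) a
    have h2 : A * (|ν * (ν + 1)| / lameOmega h ν * (1 - Real.tanh (ellipticK k))) ≤
        A * (|ν * (ν + 1)| * c * (1 - Real.tanh (ellipticK k))) := by
      have := (Real.tanh_lt_one (ellipticK k)).le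
      have : |ν * (ν + 1)| / lameOmega h ν ≤ |ν * (ν + 1)| * c := by
        rw [div_eq_mul_one_div]
        gcongr
      gcongr
    linarith
  · have e : lameOmega h ν ^ 2 - limitCoeff h ν t = -(ν * (ν + 1)) * (1 - Real.tanh t ^ 2) := by
      rw [lameOmega_sq hω, limitCoeff]
      ring
    rw [e, abs_mul, abs_neg, abs_of_nonneg (sub_nonneg.2 (Real.tanh_sq_lt_one t).le)]

/-- On [0, K] both coefficients decrease from h and stay above ω². Hence √(z'² + Q z²) starts at R
for y and v, does not grow, and dominates ω times the norm of the amplitude. -/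
theorem amplitude_bounds_of_nonneg (hω : ν * (ν + 1) < h) (hν : 0 ≤ ν * (ν + 1))
    (hk : k ∈ Set.Ioo (0 : ℝ) 1)
    {y v : ℝ → ℝ} {a : ℂ} {R : ℝ} (hy : y ∈ solutionSpace (lameCoeff h ν k))
    (hv : v ∈ solutionSpace (limitCoeff h ν)) (ha : Tendsto (amplitude (lameOmega h ν) v) atTop (𝓝 a))
    (h0 : y 0 = v 0) (h1 : deriv y 0 = deriv v 0) (hR : √(deriv v 0 ^ 2 + h * v 0 ^ 2) = R) :
    ‖amplitude (lameOmega h ν) y (ellipticK k)‖ ≤ R / lameOmega h ν ∧ ‖a‖ ≤ R / lameOmega h ν ∧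
    ‖amplitude (lameOmega h ν) y (ellipticK k) - a‖ ≤ R / lameOmega h ν *
      (|ν * (ν + 1)| * (1 / lameOmega h ν) *
        (ellipticE k + 1 - 2 * Real.tanh (ellipticK k))) := by
  have hω0 := lameOmega_pos hω
  have hω2 := lameOmega_sq hω
  have hK := (ellipticK_pos hk).le
  have hq (t : ℝ) : lameOmega h ν ^ 2 ≤ lameCoeff h ν k t := by
    rw [hω2, lameCoeff, mul_assoc (ν * (ν + 1))]
    nlinarith [sq_mul_jacobiSn_sq_le hk t]
  have hp (t : ℝ) : lameOmega h ν ^ 2 ≤ limitCoeff h ν t := by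
    rw [hω2, limitCoeff]
    nlinarith [Real.tanh_sq_lt_one t]
  have hq' : ∀ t ∈ Set.Icc 0 (ellipticK k), -(ν * (ν + 1)) * (2 * k ^ 2 *
      (jacobiSn t k * Real.cos (jacobiAm k t) * jacobiDn k t)) ≤ 0 := fun t ht => by
    have a1 := jacobiSn_nonneg hk ht.1 ht.2
    have a2 := cos_jacobiAm_nonneg hk ht.1 ht.2
    have a3 := jacobiDn_pos hk t
    rw [neg_mul, neg_nonpos]
    positivity
  have le_amp {Q : ℝ → ℝ} (w : ℝ → ℝ) {t : ℝ} {C : ℝ} (hQ : lameOmega h ν ^ 2 ≤ Q t)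
      (hC : √(deriv w t ^ 2 + Q t * w t ^ 2) ≤ C) :
      ‖amplitude (lameOmega h ν) w t‖ ≤ C / lameOmega h ν := by
    rw [norm_amplitude hω0]
    gcongr
    refine le_trans (Real.sqrt_le_sqrt ?_) hC
    gcongr
  have hA (t : ℝ) (ht : 0 ≤ t) : ‖amplitude (lameOmega h ν) v t‖ ≤ R / lameOmega h ν := by
    refine le_amp v (hp t) ?_
    have := sqrt_energy_le_of_deriv_nonpos (r := 0) (G := 0) (g := 0) ht
      (fun t _ => (hv.1 t).hasDerivAt) (fun t _ => hasDerivAt_of_mem_solutionSpace hv t)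
      (fun t _ => hasDerivAt_limitCoeff t) (fun t _ => hasDerivAt_const t 0)
      (fun t _ => (sq_nonneg _).trans (hp t)) (fun t ht => ?_) (fun t _ => by simp)
    · simpa [limitCoeff, hR] using this
    · have a1 := Real.tanh_nonneg ht.1
      have a2 := sub_nonneg.2 (Real.tanh_sq_lt_one t).le
      rw [neg_mul, neg_nonpos]
      positivity
  refine ⟨?_, norm_amplitude_sub_le_of_bounds hω hk hy hv ha hA le_rfl ?_⟩
  · refine le_amp y (hq _) ?_
    have := sqrt_energy_le_of_deriv_nonpos (r := 0) (G := 0) (g := 0) hK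
      (fun t _ => (hy.1 t).hasDerivAt) (fun t _ => hasDerivAt_of_mem_solutionSpace hy t)
      (fun t _ => hasDerivAt_lameCoeff hk t) (fun t _ => hasDerivAt_const t 0)
      (fun t _ => (sq_nonneg _).trans (hq t)) hq' (fun t _ => by simp)
    simpa [lameCoeff_zero hk, h0, h1, hR] using this
  -- The difference y - v has zero initial data, so its energy at K is controlled by the integrated
  -- source alone.
  · have := sqrt_energy_le_of_deriv_nonpos (z := y - v)
      (r := fun t => (limitCoeff h ν t - lameCoeff h ν k t) * v t)
      (G := fun t => |ν * (ν + 1)| * (R / lameOmega h ν) * (jacobiEpsilon k t - Real.tanh t)) hK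
      (fun t _ => ((hy.1 t).sub (hv.1 t)).hasDerivAt) (fun t _ => hasDerivAt_deriv_sub hy hv t)
      (fun t _ => hasDerivAt_lameCoeff hk t)
      (fun t _ => ((hasDerivAt_jacobiEpsilon hk t).sub (Real.hasDerivAt_tanh_one_sub_sq t)).const_mul _)
      (fun t _ => (sq_nonneg _).trans (hq t)) hq'
      (fun t ht => abs_coeff_diff_mul_le hk ht.1 ht.2
        ((abs_le_norm_amplitude hω0 v t).trans (hA t ht.1)))
    rw [deriv_sub (hy.1 0) (hv.1 0)] at this
    simp only [Pi.sub_apply, h0, h1, sub_self, jacobiEpsilon_zero hk, Real.tanh_zero,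
      jacobiEpsilon_ellipticK hk, mul_zero, sub_zero] at this
    refine (le_amp (y - v) (hq _) this).trans (le_of_eq ?_)
    simp
    ring

/-- On [0, K] both coefficients increase from h and stay below ω². Hence √(z² + z'²/Q) starts at R
for y and v, does not grow, and dominates the norm of the amplitude. -/
theorem amplitude_bounds_of_neg (hh : 0 < h) (hν : ν * (ν + 1) < 0)
    (hk : k ∈ Set.Ioo (0 : ℝ) 1)
    {y v : ℝ → ℝ} {a : ℂ} {R : ℝ} (hy : y ∈ solutionSpace (lameCoeff h ν k))
    (hv : v ∈ solutionSpace (limitCoeff h ν)) (ha : Tendsto (amplitude (lameOmega h ν) v) atTop (𝓝 a))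
    (h0 : y 0 = v 0) (h1 : deriv y 0 = deriv v 0) (hR : √(v 0 ^ 2 + deriv v 0 ^ 2 / h) = R) :
    ‖amplitude (lameOmega h ν) y (ellipticK k)‖ ≤ R ∧ ‖a‖ ≤ R ∧
    ‖amplitude (lameOmega h ν) y (ellipticK k) - a‖ ≤ R * (|ν * (ν + 1)| * (1 / √h) *
      (ellipticE k + 1 - 2 * Real.tanh (ellipticK k))) := by
  have hω : ν * (ν + 1) < h := hν.trans hh
  have hω0 := lameOmega_pos hω
  have hω2 := lameOmega_sq hω
  have hK := (ellipticK_pos hk).le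
  have hsq : 0 < √h := Real.sqrt_pos.2 hh
  have hq (t : ℝ) : h ≤ lameCoeff h ν k t ∧ lameCoeff h ν k t ≤ lameOmega h ν ^ 2 := by
    have : 0 ≤ k ^ 2 * jacobiSn t k ^ 2 := by positivity
    rw [hω2, lameCoeff, mul_assoc (ν * (ν + 1))]
    constructor <;> nlinarith [sq_mul_jacobiSn_sq_le hk t]
  have hp (t : ℝ) : h ≤ limitCoeff h ν t ∧ limitCoeff h ν t ≤ lameOmega h ν ^ 2 := by
    rw [hω2, limitCoeff]
    constructor <;> nlinarith [Real.tanh_sq_lt_one t, sq_nonneg (Real.tanh t)]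
  have hq' : ∀ t ∈ Set.Icc 0 (ellipticK k), 0 ≤ -(ν * (ν + 1)) * (2 * k ^ 2 *
      (jacobiSn t k * Real.cos (jacobiAm k t) * jacobiDn k t)) := fun t ht => by
    have a1 := jacobiSn_nonneg hk ht.1 ht.2
    have a2 := cos_jacobiAm_nonneg hk ht.1 ht.2
    have a3 := jacobiDn_pos hk t
    have a4 : 0 ≤ -(ν * (ν + 1)) := by linarith
    positivity
  have le_amp {Q : ℝ → ℝ} (w : ℝ → ℝ) {t : ℝ} {C : ℝ} (hQ : h ≤ Q t ∧ Q t ≤ lameOmega h ν ^ 2)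
      (hC : √(w t ^ 2 + deriv w t ^ 2 / Q t) ≤ C) : ‖amplitude (lameOmega h ν) w t‖ ≤ C := by
    rw [norm_amplitude' hω0]
    refine le_trans (Real.sqrt_le_sqrt ?_) hC
    have := hh.trans_le hQ.1
    gcongr
    exact hQ.2
  have hA (t : ℝ) (ht : 0 ≤ t) : ‖amplitude (lameOmega h ν) v t‖ ≤ R := by
    refine le_amp v (hp t) ?_
    have := sqrt_energy_le_of_deriv_nonneg (r := 0) (G := 0) (g := 0) hh ht
      (fun t _ => (hv.1 t).hasDerivAt) (fun t _ => hasDerivAt_of_mem_solutionSpace hv t)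
      (fun t _ => hasDerivAt_limitCoeff t) (fun t _ => hasDerivAt_const t 0)
      (fun t _ => (hp t).1) (fun t ht => ?_) (fun t _ => by simp)
    · simpa [limitCoeff, hR] using this
    · have a1 := Real.tanh_nonneg ht.1
      have a2 := sub_nonneg.2 (Real.tanh_sq_lt_one t).le
      have a4 : 0 ≤ -(ν * (ν + 1)) := by linarith
      positivity
  have hc : 1 / lameOmega h ν ≤ 1 / √h :=
    one_div_le_one_div_of_le hsq (Real.sqrt_le_sqrt (by linarith))
  refine ⟨?_, norm_amplitude_sub_le_of_bounds hω hk hy hv ha hA hc ?_⟩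
  · refine le_amp y (hq _) ?_
    have := sqrt_energy_le_of_deriv_nonneg (r := 0) (G := 0) (g := 0) hh hK
      (fun t _ => (hy.1 t).hasDerivAt) (fun t _ => hasDerivAt_of_mem_solutionSpace hy t)
      (fun t _ => hasDerivAt_lameCoeff hk t) (fun t _ => hasDerivAt_const t 0)
      (fun t _ => (hq t).1) hq' (fun t _ => by simp)
    simpa [lameCoeff_zero hk, h0, h1, hR] using this
  -- Here m = h, so the source is measured against √h; this is the origin of the factor 1/√h in the
  -- estimate.
  · have := sqrt_energy_le_of_deriv_nonneg (z := y - v)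
      (r := fun t => (limitCoeff h ν t - lameCoeff h ν k t) * v t)
      (G := fun t => 1 / √h * (|ν * (ν + 1)| * R * (jacobiEpsilon k t - Real.tanh t))) hh hK
      (fun t _ => ((hy.1 t).sub (hv.1 t)).hasDerivAt) (fun t _ => hasDerivAt_deriv_sub hy hv t)
      (fun t _ => hasDerivAt_lameCoeff hk t)
      (fun t _ => (((hasDerivAt_jacobiEpsilon hk t).sub
        (Real.hasDerivAt_tanh_one_sub_sq t)).const_mul _).const_mul _)
      (fun t _ => (hq t).1) hq' (fun t ht => by
        rw [← mul_assoc, mul_one_div_cancel hsq.ne', one_mul]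
        exact abs_coeff_diff_mul_le hk ht.1 ht.2
          ((abs_le_norm_amplitude hω0 v t).trans (hA t ht.1)))
    rw [deriv_sub (hy.1 0) (hv.1 0)] at this
    simp only [Pi.sub_apply, h0, h1, sub_self, jacobiEpsilon_zero hk, Real.tanh_zero,
      jacobiEpsilon_ellipticK hk, mul_zero, sub_zero] at this
    refine (le_amp (y - v) (hq _) this).trans (le_of_eq ?_)
    simp
    ring

end Comparison

/-! ### Power series with coefficients of polynomial growth. -/

section PowerSum

/-- The sum of the power series with coefficients `a`. -/
def powerSum (a : ℕ → ℂ) (z : ℂ) : ℂ := ∑' n, a n * z ^ n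

/-- The coefficients of the derivative of a power series. -/
def derivCoeff (a : ℕ → ℂ) (n : ℕ) : ℂ := (n + 1) * a (n + 1)

/-- The coefficients of the image of a power series under `z d/dz`. -/
def eulerCoeff (a : ℕ → ℂ) (n : ℕ) : ℂ := n * a n

/-- Sequences of at most polynomial growth. -/
def PolyBounded (a : ℕ → ℂ) : Prop := ∃ (C : ℝ) (d : ℕ), ∀ n, ‖a n‖ ≤ C * (n + 1) ^ d

variable {a b : ℕ → ℂ} {z : ℂ}

theorem PolyBounded.eulerCoeff (ha : PolyBounded a) : PolyBounded (eulerCoeff a) := by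
  obtain ⟨C, d, h⟩ := ha
  refine ⟨C, d + 1, fun n => ?_⟩
  rw [Lame.eulerCoeff, norm_mul, Complex.norm_natCast, pow_succ', mul_left_comm]
  exact mul_le_mul (by linarith) (h n) (norm_nonneg _) (by positivity)

theorem PolyBounded.shift (ha : PolyBounded a) : PolyBounded fun n => a (n + 1) := by
  obtain ⟨C, d, h⟩ := ha
  have hC : 0 ≤ C := by simpa using (norm_nonneg _).trans (h 0)
  refine ⟨C * 2 ^ d, d, fun n => (h (n + 1)).trans ?_⟩
  rw [mul_assoc, ← mul_pow]
  push_cast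
  gcongr
  linarith

theorem PolyBounded.derivCoeff (ha : PolyBounded a) : PolyBounded (derivCoeff a) := by
  convert! ha.eulerCoeff.shift using 2 with n
  simp [Lame.derivCoeff, Lame.eulerCoeff]

theorem PolyBounded.sub (ha : PolyBounded a) (hb : PolyBounded b) :
    PolyBounded fun n => a n - b n := by
  obtain ⟨C, d, h⟩ := ha
  obtain ⟨C', d', h'⟩ := hb
  have hC : 0 ≤ C := by simpa using (norm_nonneg _).trans (h 0)
  have hC' : 0 ≤ C' := by simpa using (norm_nonneg _).trans (h' 0)
  refine ⟨C + C', max d d', fun n => (norm_sub_le _ _).trans ?_⟩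
  have h1 : (1 : ℝ) ≤ n + 1 := by linarith [n.cast_nonneg (α := ℝ)]
  rw [add_mul]
  refine add_le_add ((h n).trans ?_) ((h' n).trans ?_)
  · gcongr
    exact le_max_left _ _
  · gcongr
    exact le_max_right _ _

theorem summable_succ_pow_mul_geometric (d : ℕ) {r : ℝ} (h0 : 0 ≤ r) (h1 : r < 1) :
    Summable fun n : ℕ => ((n : ℝ) + 1) ^ d * r ^ n := by
  rcases h0.eq_or_lt with rfl | hr
  · exact summable_of_ne_finset_zero (s := {0}) fun n hn => by
      rw [zero_pow (by simpa using hn), mul_zero]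
  · have h := (summable_nat_add_iff 1).2
      (summable_pow_mul_geometric_of_norm_lt_one d (r := r) (by rwa [Real.norm_of_nonneg h0]))
    refine (summable_mul_left_iff hr.ne').1 (h.congr fun n => ?_)
    push_cast
    ring

theorem PolyBounded.summable_norm_mul (ha : PolyBounded a) {r : ℝ} (h0 : 0 ≤ r) (h1 : r < 1) :
    Summable fun n => ‖a n‖ * r ^ n := by
  obtain ⟨C, d, h⟩ := ha
  refine Summable.of_nonneg_of_le (fun n => by positivity) (fun n => ?_)
    ((summable_succ_pow_mul_geometric d h0 h1).mul_left C)
  rw [← mul_assoc]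
  exact mul_le_mul_of_nonneg_right (h n) (by positivity)

theorem PolyBounded.hasSum (ha : PolyBounded a) (hz : ‖z‖ < 1) :
    HasSum (fun n => a n * z ^ n) (powerSum a z) := by
  refine (Summable.of_norm ?_).hasSum
  simpa using ha.summable_norm_mul (norm_nonneg z) hz

theorem mul_powerSum_derivCoeff (ha : PolyBounded a) (hz : ‖z‖ < 1) :
    z * powerSum (derivCoeff a) z = powerSum (eulerCoeff a) z := by
  have h1 := (ha.derivCoeff.hasSum hz).mul_left z
  have h2 := (hasSum_nat_add_iff' 1).2 (ha.eulerCoeff.hasSum hz)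
  simp only [Finset.sum_range_one, eulerCoeff, Nat.cast_zero, zero_mul, sub_zero] at h2
  refine h1.unique ?_
  convert! h2 using 2 with n
  simp only [derivCoeff]
  push_cast
  ring

/-- Termwise differentiation on a disc of radius r with ‖z‖ < r < 1. Polynomial growth survives z
d/dz, so the differentiated series is dominated there. -/
theorem hasDerivAt_powerSum (ha : PolyBounded a) (hz : ‖z‖ < 1) :
    HasDerivAt (powerSum a) (powerSum (derivCoeff a) z) z := by
  obtain ⟨r, hr, hr1⟩ := exists_between hz
  have hr0 : 0 ≤ r := (norm_nonneg z).trans hr.le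
  have hu : Summable fun n => ‖eulerCoeff a n‖ * r ^ (n - 1) := by
    rw [← summable_nat_add_iff 1]
    simpa using ha.eulerCoeff.shift.summable_norm_mul hr0 hr1
  have hd := hasDerivAt_tsum_of_isPreconnected (𝕜 := ℂ) (g := fun n z => a n * z ^ n)
    (g' := fun n z => a n * (n * z ^ (n - 1))) hu (Metric.isOpen_ball (x := (0 : ℂ)) (ε := r))
    (convex_ball _ _).isPreconnected (fun n w _ => (hasDerivAt_pow n w).const_mul _)
    (fun n w hw => ?_) (y₀ := z) (by simpa using hr) (ha.hasSum hz).summable (y := z)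
    (by simpa using hr)
  · convert! hd using 1
    have hs : Summable fun n => a n * (n * z ^ (n - 1)) := by
      rw [← summable_nat_add_iff 1]
      convert! (ha.derivCoeff.hasSum hz).summable using 2 with n
      simp only [derivCoeff, Nat.add_sub_cancel]
      push_cast
      ring
    rw [hs.tsum_eq_zero_add]
    simp only [Nat.cast_zero, zero_mul, mul_zero, zero_add, powerSum, derivCoeff]
    congr 1
    funext n
    push_cast
    ring
  · have hw' : ‖w‖ ≤ r := (mem_ball_zero_iff.1 hw).le
    rw [eulerCoeff, ← mul_assoc, mul_comm (a n), norm_mul, norm_pow]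
    gcongr

theorem powerSum_zero_right (a : ℕ → ℂ) : powerSum a 0 = a 0 := by
  rw [powerSum, tsum_eq_single 0 fun n hn => by simp [hn]]
  simp

end PowerSum

/-! ### The hypergeometric series at 1/2 and the Gamma quotient. -/

section Hypergeometric

/-- The coefficients of the hypergeometric series `₂F₁(-ν, ν + 1; c; z)`, where `l = ν (ν + 1)`. -/
def hypCoeff (l c : ℂ) : ℕ → ℂ
  | 0 => 1
  | n + 1 => hypCoeff l c n * ((n * (n + 1) - l) / ((c + n) * (n + 1)))

variable {l c z : ℂ}

theorem add_natCast_ne_zero_of_one_le_re (hc : 1 ≤ c.re) (n : ℕ) : c + n ≠ 0 := fun h => by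
  have := congrArg Complex.re h
  simp at this
  linarith [n.cast_nonneg (α := ℝ)]

theorem norm_hypCoeff_succ_le (hc : 1 ≤ c.re) (n : ℕ) : ‖hypCoeff l c (n + 1)‖ ≤
    ‖hypCoeff l c n‖ * ((n * (n + 1) + ‖l‖) / ((c.re + n) * (n + 1))) := by
  have h1 : c.re + n ≤ ‖c + n‖ := by simpa using Complex.re_le_norm (c + n)
  have h2 : ‖(n + 1 : ℂ)‖ = n + 1 := by
    rw [← Nat.cast_succ, Complex.norm_natCast, Nat.cast_succ]
  have h3 : ‖(n * (n + 1) - l : ℂ)‖ ≤ n * (n + 1) + ‖l‖ := by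
    refine (norm_sub_le _ _).trans ?_
    rw [norm_mul, h2, Complex.norm_natCast]
  rw [hypCoeff, norm_mul, norm_div, norm_mul, h2]
  gcongr

/-- A bound for the coefficients `hypCoeff l c` that is uniform in `c`. -/
def hypBound (l : ℂ) : ℝ := Real.exp (∑' n : ℕ, ‖l‖ * (1 / ((n : ℝ) + 1) ^ 2))

/-- Successive ratios are at most 1 + ‖l‖/(n+1)² ≤ exp(‖l‖/(n+1)²), and these factors have a
convergent product. Independence of c is what permits dominated convergence as c → ∞. -/
theorem norm_hypCoeff_le (hc : 1 ≤ c.re) (n : ℕ) : ‖hypCoeff l c n‖ ≤ hypBound l := by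
  have hs : Summable fun n : ℕ => ‖l‖ * (1 / ((n : ℝ) + 1) ^ 2) := by
    refine Summable.mul_left _ ?_
    have := (summable_nat_add_iff 1).2 (Real.summable_one_div_nat_pow.2 one_lt_two)
    simpa using this
  have main : ‖hypCoeff l c n‖ ≤
      Real.exp (∑ j ∈ Finset.range n, ‖l‖ * (1 / ((j : ℝ) + 1) ^ 2)) := by
    induction n with
    | zero => simp [hypCoeff]
    | succ n ih =>
      rw [Finset.sum_range_succ, Real.exp_add]
      refine (norm_hypCoeff_succ_le hc n).trans ?_
      refine mul_le_mul ih ?_ (by positivity) (Real.exp_pos _).le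
      refine le_trans ?_ (Real.add_one_le_exp _)
      calc (n * (n + 1) + ‖l‖) / ((c.re + n) * (n + 1))
          ≤ ((n + 1) * (n + 1) + ‖l‖) / ((n + 1) * (n + 1)) := by
            have := n.cast_nonneg (α := ℝ)
            have h1 : (n + 1 : ℝ) ≤ c.re + n := by linarith
            refine div_le_div₀ (by positivity) ?_ (by positivity) ?_
            · nlinarith
            · exact mul_le_mul_of_nonneg_right h1 (by positivity)
        _ = _ := by field_simp; ring
  exact main.trans (Real.exp_le_exp.2 (hs.sum_le_tsum _ fun _ _ => by positivity))

theorem polyBounded_hypCoeff (hc : 1 ≤ c.re) : PolyBounded (hypCoeff l c) :=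
  ⟨hypBound l, 0, fun n => by simpa using norm_hypCoeff_le hc n⟩

/-- The hypergeometric function `₂F₁(-ν, ν + 1; c; z)`, where `l = ν (ν + 1)`. -/
def hyp (l c z : ℂ) : ℂ := powerSum (hypCoeff l c) z

/-- The derivative of `hyp`. -/
def hypDeriv (l c z : ℂ) : ℂ := powerSum (derivCoeff (hypCoeff l c)) z

/-- The second derivative of `hyp`. -/
def hypDeriv₂ (l c z : ℂ) : ℂ := powerSum (derivCoeff (derivCoeff (hypCoeff l c))) z

theorem hasDerivAt_hyp (hc : 1 ≤ c.re) (hz : ‖z‖ < 1) :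
    HasDerivAt (hyp l c) (hypDeriv l c z) z :=
  hasDerivAt_powerSum (polyBounded_hypCoeff hc) hz

theorem hasDerivAt_hypDeriv (hc : 1 ≤ c.re) (hz : ‖z‖ < 1) :
    HasDerivAt (hypDeriv l c) (hypDeriv₂ l c z) z :=
  hasDerivAt_powerSum (polyBounded_hypCoeff hc).derivCoeff hz

theorem hyp_zero : hyp l c 0 = 1 := powerSum_zero_right _

theorem hypCoeff_rec (hc : 1 ≤ c.re) (n : ℕ) :
    (n + 1) * (c + n) * hypCoeff l c (n + 1) = (n * (n + 1) - l) * hypCoeff l c n := by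
  have h1 := add_natCast_ne_zero_of_one_le_re hc n
  have h2 : (n + 1 : ℂ) ≠ 0 := Nat.cast_add_one_ne_zero n
  rw [hypCoeff]
  field_simp

/-- The hypergeometric differential equation. -/
theorem hyp_ode (hc : 1 ≤ c.re) (hz : ‖z‖ < 1) :
    z * (1 - z) * hypDeriv₂ l c z + (c - 2 * z) * hypDeriv l c z + l * hyp l c z = 0 := by
  have hp := polyBounded_hypCoeff (l := l) hc
  have hb : PolyBounded fun n => eulerCoeff (hypCoeff l c) n - hypCoeff l c n :=
    hp.eulerCoeff.sub hp
  have e1 := mul_powerSum_derivCoeff hp.derivCoeff hz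
  have e2 := mul_powerSum_derivCoeff hp hz
  have e3 := mul_powerSum_derivCoeff hb hz
  -- With θ = z d/dz, the derivative of (θ - 1)F is z F''; hence z² F'' = θ(θ - 1)F, and all terms
  -- of the equation can be compared index by index.
  have e4 : derivCoeff (fun n => eulerCoeff (hypCoeff l c) n - hypCoeff l c n) =
      eulerCoeff (derivCoeff (hypCoeff l c)) := by
    funext n
    simp only [derivCoeff, eulerCoeff]
    push_cast
    ring
  rw [e4, ← e1] at e3
  have h := ((((hp.derivCoeff.eulerCoeff.hasSum hz).sub (hb.eulerCoeff.hasSum hz)).add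
    ((hp.derivCoeff.hasSum hz).mul_left c)).sub ((hp.eulerCoeff.hasSum hz).mul_left 2)).add
    ((hp.hasSum hz).mul_left l)
  rw [← e1, ← e2, ← e3] at h
  have h0 := h.unique (a₂ := 0) (by
    convert! (hasSum_zero : HasSum (fun _ : ℕ => (0 : ℂ)) 0) using 2 with n
    simp only [derivCoeff, eulerCoeff]
    linear_combination z ^ n * hypCoeff_rec (l := l) hc n)
  simp only [hypDeriv₂, hypDeriv, hyp]
  linear_combination h0

theorem hypCoeff_contiguous (hc : 1 ≤ c.re) (n : ℕ) :
    (c + n) * hypCoeff l (c + 1) n = c * hypCoeff l c n := by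
  induction n with
  | zero => simp [hypCoeff]
  | succ n ih =>
    have h1 := add_natCast_ne_zero_of_one_le_re hc n
    have h2 : c + 1 + n ≠ 0 := add_natCast_ne_zero_of_one_le_re (by simp; linarith) n
    have h3 : (n + 1 : ℂ) ≠ 0 := Nat.cast_add_one_ne_zero n
    rw [hypCoeff, hypCoeff, ← mul_assoc c, ← ih]
    push_cast
    rw [show c + (n + 1 : ℂ) = c + 1 + n by ring]
    field_simp

/-- The operator c + z d/dz lowers the parameter c + 1 to c, since the coefficients satisfy (c + n)
aₙ(c+1) = c aₙ(c). -/
theorem hyp_contiguous (hc : 1 ≤ c.re) (hz : ‖z‖ < 1) :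
    c * hyp l c z = c * hyp l (c + 1) z + z * hypDeriv l (c + 1) z := by
  have hp := polyBounded_hypCoeff (l := l) hc
  have hp' := polyBounded_hypCoeff (l := l) (c := c + 1) (by simp; linarith)
  have e := mul_powerSum_derivCoeff hp' hz
  have h := ((hp'.hasSum hz).mul_left c).add (hp'.eulerCoeff.hasSum hz)
  rw [← e] at h
  refine ((hp.hasSum hz).mul_left c).unique ?_
  convert! h using 2 with n
  simp only [eulerCoeff]
  linear_combination (-z ^ n) * hypCoeff_contiguous (l := l) hc n

theorem hypDeriv_contiguous (hc : 1 ≤ c.re) (hz : ‖z‖ < 1) :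
    c * hypDeriv l c z = (c + 1) * hypDeriv l (c + 1) z + z * hypDeriv₂ l (c + 1) z := by
  have hp := polyBounded_hypCoeff (l := l) hc
  have hp' := polyBounded_hypCoeff (l := l) (c := c + 1) (by simp; linarith)
  have e := mul_powerSum_derivCoeff hp'.derivCoeff hz
  have h := ((hp'.derivCoeff.hasSum hz).mul_left (c + 1)).add (hp'.derivCoeff.eulerCoeff.hasSum hz)
  rw [← e] at h
  refine ((hp.derivCoeff.hasSum hz).mul_left c).unique ?_
  convert! h using 2 with n
  simp only [eulerCoeff, derivCoeff]
  have := hypCoeff_contiguous (l := l) hc (n + 1)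
  push_cast at this
  linear_combination (-z ^ n * (n + 1)) * this

/-- The product of the values at `t = 0` of the Jost solution with exponent `μ = c - 1` and of its
negative derivative. -/
def jostProduct (l c : ℂ) : ℂ :=
  hyp l c (1 / 2) * ((c - 1) * hyp l c (1 / 2) + 1 / 2 * hypDeriv l c (1 / 2))

/-- At z = 1/2 the two factors exchange roles under c ↦ c + 1: by contiguity c F(c) is the
derivative factor at c + 1, and by the differential equation c times the derivative factor at c is
(c(c-1) - l) F(c+1). So the product, unlike its factors, satisfies a one-step recurrence. -/
theorem jostProduct_rec (hc : 1 ≤ c.re) :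
    c ^ 2 * jostProduct l c = (c * (c - 1) - l) * jostProduct l (c + 1) := by
  have hz : ‖(1 / 2 : ℂ)‖ < 1 := by norm_num
  have h1 := hyp_contiguous (l := l) hc hz
  have h2 := hypDeriv_contiguous (l := l) hc hz
  have h3 := hyp_ode (l := l) (c := c + 1) (by simp; linarith) hz
  have h4 : c * ((c - 1) * hyp l c (1 / 2) + 1 / 2 * hypDeriv l c (1 / 2)) =
      (c * (c - 1) - l) * hyp l (c + 1) (1 / 2) := by
    linear_combination (c - 1) * h1 + 1 / 2 * h2 + h3
  simp only [jostProduct]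
  linear_combination c * hyp l c (1 / 2) * h4 +
    (c * (c - 1) - l) * hyp l (c + 1) (1 / 2) * h1

theorem tendsto_hypCoeff_succ {u : ℕ → ℂ} (hu : ∀ j : ℕ, (j : ℝ) + 1 ≤ (u j).re) (n : ℕ) :
    Tendsto (fun j => hypCoeff l (u j) (n + 1)) atTop (𝓝 0) := by
  have h1 (j : ℕ) : 1 ≤ (u j).re := by linarith [hu j, j.cast_nonneg (α := ℝ)]
  refine squeeze_zero_norm (a := fun j : ℕ => hypBound l * (n * (n + 1) + ‖l‖) *
    (1 / ((j : ℝ) + 1))) (fun j => ?_) ?_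
  · refine (norm_hypCoeff_succ_le (h1 j) n).trans ?_
    have h2 : (j : ℝ) + 1 ≤ ((u j).re + n) * (n + 1) := by
      nlinarith [hu j, n.cast_nonneg (α := ℝ), j.cast_nonneg (α := ℝ), h1 j]
    have h3 := norm_hypCoeff_le (l := l) (h1 j) n
    have h4 := (norm_nonneg _).trans h3
    have h5 := zero_le_one.trans (h1 j)
    calc ‖hypCoeff l (u j) n‖ * ((n * (n + 1) + ‖l‖) / (((u j).re + n) * (n + 1)))
        ≤ hypBound l * ((n * (n + 1) + ‖l‖) / ((j : ℝ) + 1)) := by gcongr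
      _ = _ := by ring
  · simpa using tendsto_one_div_add_atTop_nhds_zero_nat.const_mul
      (hypBound l * (n * (n + 1) + ‖l‖))

theorem tendsto_hyp_half {u : ℕ → ℂ} (hu : ∀ j : ℕ, (j : ℝ) + 1 ≤ (u j).re) :
    Tendsto (fun j => hyp l (u j) (1 / 2)) atTop (𝓝 1) := by
  have h1 (j : ℕ) : 1 ≤ (u j).re := by linarith [hu j, j.cast_nonneg (α := ℝ)]
  have h := tendsto_tsum_of_dominated_convergence (𝓕 := atTop)
    (f := fun j n => hypCoeff l (u j) n * (1 / 2) ^ n) (g := fun n => if n = 0 then (1 : ℂ) else 0)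
    (bound := fun n => hypBound l * (1 / 2) ^ n)
    ((summable_geometric_of_lt_one (by norm_num) (by norm_num)).mul_left _) (fun n => ?_)
    (.of_forall fun j n => ?_)
  · simpa [hyp, powerSum] using h
  · cases n with
    | zero => simp [hypCoeff]
    | succ n => simpa using (tendsto_hypCoeff_succ (l := l) hu n).mul_const ((1 / 2 : ℂ) ^ (n + 1))
  · rw [norm_mul, norm_pow]
    have := norm_hypCoeff_le (l := l) (h1 j) n
    norm_num
    gcongr

theorem tendsto_hypDeriv_half {u : ℕ → ℂ} (hu : ∀ j : ℕ, (j : ℝ) + 1 ≤ (u j).re) :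
    Tendsto (fun j => hypDeriv l (u j) (1 / 2)) atTop (𝓝 0) := by
  have h1 (j : ℕ) : 1 ≤ (u j).re := by linarith [hu j, j.cast_nonneg (α := ℝ)]
  have h := tendsto_tsum_of_dominated_convergence (𝓕 := atTop)
    (f := fun j n => derivCoeff (hypCoeff l (u j)) n * (1 / 2) ^ n) (g := fun _ => (0 : ℂ))
    (bound := fun n => hypBound l * (((n : ℝ) + 1) ^ 1 * (1 / 2) ^ n))
    ((summable_succ_pow_mul_geometric 1 (by norm_num) (by norm_num)).mul_left _) (fun n => ?_)
    (.of_forall fun j n => ?_)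
  · simpa [hypDeriv, powerSum] using h
  · simpa [derivCoeff] using ((tendsto_hypCoeff_succ (l := l) hu n).const_mul
      (n + 1 : ℂ)).mul_const ((1 / 2 : ℂ) ^ n)
  · have h2 : ‖(n + 1 : ℂ)‖ = n + 1 := by
      rw [← Nat.cast_succ, Complex.norm_natCast, Nat.cast_succ]
    rw [derivCoeff, norm_mul, norm_mul, h2, norm_pow, pow_one, ← mul_assoc, mul_comm (hypBound l)]
    have := norm_hypCoeff_le (l := l) (h1 j) (n + 1)
    norm_num
    gcongr

/-- As c → ∞ the value at 1/2 tends to 1 and the derivative to 0, so the product is asymptotic to c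
- 1 = μ + n. -/
theorem tendsto_jostProduct {μ : ℂ} (hμ : 0 ≤ μ.re) (hμ0 : μ ≠ 0) :
    Tendsto (fun n : ℕ => jostProduct l (1 + μ + n) / (μ + n)) atTop (𝓝 1) := by
  have hu (j : ℕ) : (j : ℝ) + 1 ≤ (1 + μ + j).re := by simp; linarith
  have hne (n : ℕ) : μ + n ≠ 0 := fun h => by
    have h1 := congrArg Complex.re h
    simp at h1
    have h2 : (n : ℝ) = 0 := le_antisymm (by linarith) n.cast_nonneg
    have h3 : n = 0 := by exact_mod_cast h2
    subst h3
    simp [hμ0] at h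
  have hinv : Tendsto (fun n : ℕ => (μ + n)⁻¹) atTop (𝓝 0) := by
    refine (tendsto_add_atTop_iff_nat 1).1 ?_
    refine squeeze_zero_norm (fun n => ?_) tendsto_one_div_add_atTop_nhds_zero_nat
    rw [norm_inv, one_div]
    gcongr
    have := Complex.re_le_norm (μ + (n + 1 : ℕ))
    simp at this
    push_cast
    linarith
  have h1 := tendsto_hyp_half (l := l) hu
  have h2 := tendsto_hypDeriv_half (l := l) hu
  have h := h1.mul (h1.add ((h2.const_mul (1 / 2 : ℂ)).mul hinv))
  simp only [mul_zero, add_zero, mul_one] at h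
  refine h.congr fun n => ?_
  have := hne n
  rw [jostProduct]
  field_simp
  ring

/-- Iteration of the recurrence, using c(c-1) - ν(ν+1) = (c + ν)(c - 1 - ν). -/
theorem jostProduct_eq_prod {μ ν : ℂ} (hμ : 0 ≤ μ.re) (hμ0 : ∀ n : ℕ, μ + n ≠ 0) (n : ℕ) :
    jostProduct (ν * (ν + 1)) (1 + μ) =
      (∏ j ∈ Finset.range n, ((1 + μ + ν + j) * (μ - ν + j) / ((1 + μ + j) * (μ + j)))) *
        (μ * (jostProduct (ν * (ν + 1)) (1 + μ + n) / (μ + n))) := by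
  have h0 : μ ≠ 0 := by simpa using hμ0 0
  induction n with
  | zero =>
    simp
    field_simp
  | succ n ih =>
    have h1 := jostProduct_rec (l := ν * (ν + 1)) (c := 1 + μ + n) (by
      simpa [add_assoc] using add_nonneg hμ n.cast_nonneg)
    have h2 : 1 + μ + n ≠ 0 := add_natCast_ne_zero_of_one_le_re (by simpa using hμ) n
    have h3 := hμ0 n
    have h4 : jostProduct (ν * (ν + 1)) (1 + μ + n) = (1 + μ + ν + n) * (μ - ν + n) *
        jostProduct (ν * (ν + 1)) (1 + μ + n + 1) / (1 + μ + n) ^ 2 := by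
      rw [eq_div_iff (pow_ne_zero 2 h2)]
      linear_combination h1
    rw [ih, h4, Finset.prod_range_succ]
    push_cast
    rw [show μ + (n + 1 : ℂ) = 1 + μ + n by ring, ← add_assoc (1 + μ)]
    field_simp

/-- The finite products are quotients of Gauss's approximations to Γ. The powers of n cancel because
(1 + μ) + μ = (1 + μ + ν) + (μ - ν), and the factorials cancel as well. -/
theorem jostProduct_eq_Gamma {μ ν : ℂ} (hμ : 0 ≤ μ.re) (hμ0 : μ ≠ 0)
    (h1 : ∀ n : ℕ, 1 + μ + ν ≠ -n) (h2 : ∀ n : ℕ, μ - ν ≠ -n) :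
    jostProduct (ν * (ν + 1)) (1 + μ) = μ * (Complex.Gamma (1 + μ) * Complex.Gamma μ /
      (Complex.Gamma (1 + μ + ν) * Complex.Gamma (μ - ν))) := by
  have hne (n : ℕ) : μ + n ≠ 0 := fun h => by
    have h1 := congrArg Complex.re h
    simp at h1
    have h2 : (n : ℝ) = 0 := le_antisymm (by linarith) n.cast_nonneg
    have h3 : n = 0 := by exact_mod_cast h2
    subst h3
    simp [hμ0] at h
  have hlim := ((Complex.GammaSeq_tendsto_Gamma (1 + μ)).mul
    (Complex.GammaSeq_tendsto_Gamma μ)).div ((Complex.GammaSeq_tendsto_Gamma (1 + μ + ν)).mul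
    (Complex.GammaSeq_tendsto_Gamma (μ - ν)))
    (mul_ne_zero (Complex.Gamma_ne_zero h1) (Complex.Gamma_ne_zero h2))
  -- Shifted by one because the n-th Gauss approximation has n + 1 factors in its denominator.
  have hJ := (tendsto_add_atTop_iff_nat 1).2 (tendsto_jostProduct (l := ν * (ν + 1)) hμ hμ0)
  have h := hlim.mul (hJ.const_mul μ)
  rw [mul_one, mul_comm _ μ] at h
  refine tendsto_nhds_unique (tendsto_const_nhds.congr' ?_) h
  filter_upwards [eventually_ne_atTop 0] with n hn
  rw [jostProduct_eq_prod hμ hne (n + 1)]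
  congr 1
  have hn' : (n : ℂ) ≠ 0 := Nat.cast_ne_zero.2 hn
  have hf : (n.factorial : ℂ) ≠ 0 := Nat.cast_ne_zero.2 n.factorial_ne_zero
  simp only [Pi.div_apply, Complex.GammaSeq, Finset.prod_div_distrib, Finset.prod_mul_distrib]
  have hpow : (n : ℂ) ^ (1 + μ) * (n : ℂ) ^ μ = (n : ℂ) ^ (1 + μ + ν) * (n : ℂ) ^ (μ - ν) := by
    rw [← Complex.cpow_add _ _ hn', ← Complex.cpow_add _ _ hn']
    congr 1
    ring
  have hp1 : (n : ℂ) ^ (1 + μ + ν) ≠ 0 := by simp [Complex.cpow_eq_zero_iff, hn']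
  have hp2 : (n : ℂ) ^ (μ - ν) ≠ 0 := by simp [Complex.cpow_eq_zero_iff, hn']
  have q1 : ∏ j ∈ Finset.range (n + 1), (1 + μ + j) ≠ 0 := Finset.prod_ne_zero_iff.2 fun j _ =>
    add_natCast_ne_zero_of_one_le_re (by simpa using hμ) j
  have q2 : ∏ j ∈ Finset.range (n + 1), (μ + j) ≠ 0 := Finset.prod_ne_zero_iff.2 fun j _ => hne j
  have q3 : ∏ j ∈ Finset.range (n + 1), (1 + μ + ν + j) ≠ 0 := Finset.prod_ne_zero_iff.2
    fun j _ hj => h1 j (eq_neg_of_add_eq_zero_left hj)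
  have q4 : ∏ j ∈ Finset.range (n + 1), (μ - ν + j) ≠ 0 := Finset.prod_ne_zero_iff.2
    fun j _ hj => h2 j (eq_neg_of_add_eq_zero_left hj)
  rw [div_mul_div_comm, div_mul_div_comm, div_div_div_eq, div_eq_div_iff (mul_ne_zero q1 q2)
    (by positivity)]
  linear_combination (-(n.factorial : ℂ) ^ 2 * (∏ j ∈ Finset.range (n + 1), (1 + μ + ν + j)) *
    (∏ j ∈ Finset.range (n + 1), (μ - ν + j)) * (∏ j ∈ Finset.range (n + 1), (1 + μ + j)) *
    (∏ j ∈ Finset.range (n + 1), (μ + j))) * hpow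

end Hypergeometric

open ComplexConjugate

/-! ### Jost solutions and amplitudes at infinity for the limiting equation. -/

section Jost

variable {h ν : ℝ}

/-- With z = (1 - tanh t)/2, so that z' = -2z(1 - z), the function e^{-μt} F(z) solves the limiting
equation when F solves the hypergeometric equation with c = 1 + μ. Infinity goes to z = 0, which
gives the asymptotics, and t = 0 goes to z = 1/2, which gives the product of `jostProduct`. -/
theorem exists_jost_solution (hω : ν * (ν + 1) < h) : ∃ f f' : ℝ → ℂ,
    (∀ t, HasDerivAt f (f' t) t) ∧ (∀ t, HasDerivAt f' (-(limitCoeff h ν t) * f t) t) ∧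
    Tendsto (fun t : ℝ => Complex.exp (Complex.I * lameOmega h ν * t) * f t) atTop (𝓝 1) ∧
    Tendsto (fun t : ℝ => Complex.exp (Complex.I * lameOmega h ν * t) * f' t) atTop
      (𝓝 (-(Complex.I * lameOmega h ν))) ∧
    -(f 0 * f' 0) = Complex.I * lameOmega h ν * lameB h ν := by
  have hω0 := lameOmega_pos hω
  have hω2 := lameOmega_sq hω
  set w := lameOmega h ν with hw
  set μ : ℂ := Complex.I * w with hμ
  have hμre : μ.re = 0 := by simp [hμ]
  have hμim : μ.im = w := by simp [hμ]
  have hμ0 : μ ≠ 0 := by simp [hμ, hω0.ne']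
  have hμ2 : μ ^ 2 = -(h - ν * (ν + 1) : ℝ) := by
    rw [hμ, mul_pow, Complex.I_sq, ← hω2]
    push_cast
    ring
  let l : ℂ := ν * (ν + 1)
  have hc : 1 ≤ (1 + μ).re := by simp [hμre]
  let z : ℝ → ℂ := fun t => ((1 - Real.tanh t) / 2 : ℝ)
  have hz (t : ℝ) : HasDerivAt z (-2 * (z t * (1 - z t))) t := by
    have := (((Real.hasDerivAt_tanh_one_sub_sq t).const_sub 1).div_const 2).ofReal_comp
    convert! this using 1
    simp only [z]
    push_cast
    ring
  have hz1 (t : ℝ) : ‖z t‖ < 1 := by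
    rw [Complex.norm_real, Real.norm_eq_abs, abs_lt]
    constructor <;> linarith [Real.tanh_lt_one t, Real.neg_one_lt_tanh t]
  have hz0 : z 0 = 1 / 2 := by simp [z]
  have hlim : Tendsto z atTop (𝓝 0) := by
    have ht : Tendsto (fun t : ℝ => 1 - 2 / (Real.exp (2 * t) + 1)) atTop (𝓝 (1 - 0)) := by
      refine tendsto_const_nhds.sub (Tendsto.const_div_atTop ?_ 2)
      exact tendsto_atTop_add_const_right _ _
        (Real.tendsto_exp_atTop.comp (tendsto_id.const_mul_atTop two_pos))
    have ht' : Tendsto Real.tanh atTop (𝓝 1) := by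
      rw [sub_zero] at ht
      refine ht.congr fun t => ?_
      have h1 : Real.exp (2 * t) = Real.exp t ^ 2 := by rw [← Real.exp_nat_mul]; norm_num
      rw [Real.tanh_eq, h1, Real.exp_neg]
      have := Real.exp_pos t
      field_simp
      ring
    have := (Complex.continuous_ofReal.tendsto _).comp ((ht'.const_sub 1).div_const 2)
    simpa [z, Function.comp_def] using this
  have hF (t : ℝ) : HasDerivAt (fun t => hyp l (1 + μ) (z t))
      (hypDeriv l (1 + μ) (z t) * (-2 * (z t * (1 - z t)))) t :=
    (hasDerivAt_hyp hc (hz1 t)).comp t (hz t)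
  have hF' (t : ℝ) : HasDerivAt (fun t => hypDeriv l (1 + μ) (z t))
      (hypDeriv₂ l (1 + μ) (z t) * (-2 * (z t * (1 - z t)))) t :=
    (hasDerivAt_hypDeriv hc (hz1 t)).comp t (hz t)
  have hE (t : ℝ) : HasDerivAt (fun t : ℝ => Complex.exp (-(μ * t)))
      (Complex.exp (-(μ * t)) * -(μ * 1)) t :=
    ((Complex.ofRealCLM.hasDerivAt (x := t)).const_mul μ).neg.cexp
  have hexp (t : ℝ) (x : ℂ) : Complex.exp (μ * t) * (Complex.exp (-(μ * t)) * x) = x := by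
    rw [← mul_assoc, ← Complex.exp_add]
    simp
  have hF0 : Tendsto (fun t => hyp l (1 + μ) (z t)) atTop (𝓝 1) := by
    have := (hasDerivAt_hyp (l := l) hc (z := 0) (by simp)).continuousAt.tendsto.comp hlim
    rwa [hyp_zero] at this
  have hF'0 : Tendsto (fun t => hypDeriv l (1 + μ) (z t)) atTop (𝓝 (hypDeriv l (1 + μ) 0)) :=
    (hasDerivAt_hypDeriv (l := l) hc (z := 0) (by simp)).continuousAt.tendsto.comp hlim
  refine ⟨fun t => Complex.exp (-(μ * t)) * hyp l (1 + μ) (z t),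
    fun t => Complex.exp (-(μ * t)) * (-μ * hyp l (1 + μ) (z t) -
      2 * (z t * (1 - z t)) * hypDeriv l (1 + μ) (z t)), fun t => ?_, fun t => ?_, ?_, ?_, ?_⟩
  · convert! (hE t).mul (hF t) using 1
    ring
  · convert! (hE t).mul (((hF t).const_mul (-μ)).sub
      ((((hz t).mul ((hz t).const_sub 1)).const_mul 2).mul (hF' t))) using 1
    have ode := hyp_ode (l := l) hc (hz1 t)
    have hq : (limitCoeff h ν t : ℂ) = -μ ^ 2 + 4 * l * (z t * (1 - z t)) := by
      rw [hμ2]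
      simp only [limitCoeff, l, z]
      push_cast
      ring
    rw [hq]
    simp only [Pi.mul_apply, Pi.sub_apply]
    linear_combination (-4 * Complex.exp (-(μ * t)) * (z t * (1 - z t))) * ode
  · simpa only [hexp] using hF0
  · simp only [hexp]
    have := (hF0.const_mul (-μ)).sub (((hlim.mul (hlim.const_sub 1)).const_mul 2).mul hF'0)
    simpa using this
  -- The arguments of Γ have imaginary part ω ≠ 0, so no pole occurs.
  · have h1 (n : ℕ) : 1 + μ + ν ≠ -n := fun h => by
      have := congrArg Complex.im h
      simp [hμim, hω0.ne'] at this
    have h2 (n : ℕ) : μ - ν ≠ -n := fun h => by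
      have := congrArg Complex.im h
      simp [hμim, hω0.ne'] at this
    have := jostProduct_eq_Gamma hμre.ge hμ0 h1 h2
    rw [lameB, ← hw, ← hμ, ← this, jostProduct]
    simp only [hz0, Complex.ofReal_zero, mul_zero, neg_zero, Complex.exp_zero, one_mul, l]
    ring

/-- The real solutions of the limiting equation in terms of the Jost solution. -/
theorem re_jost_solution (hω : ν * (ν + 1) < h) {f f' : ℝ → ℂ}
    (hf : ∀ t, HasDerivAt f (f' t) t) (hf' : ∀ t, HasDerivAt f' (-(limitCoeff h ν t) * f t) t)
    (h1 : Tendsto (fun t : ℝ => Complex.exp (Complex.I * lameOmega h ν * t) * f t) atTop (𝓝 1))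
    (h2 : Tendsto (fun t : ℝ => Complex.exp (Complex.I * lameOmega h ν * t) * f' t) atTop
      (𝓝 (-(Complex.I * lameOmega h ν)))) (a : ℂ) :
    (fun t => (conj a * f t).re) ∈ solutionSpace (limitCoeff h ν) ∧
    (deriv fun t => (conj a * f t).re) = (fun t => (conj a * f' t).re) ∧
    Tendsto (amplitude (lameOmega h ν) fun t => (conj a * f t).re) atTop (𝓝 a) := by
  have hω0 := lameOmega_pos hω
  set w := lameOmega h ν with hw
  set μ : ℂ := Complex.I * w with hμ
  have hμ0 : μ ≠ 0 := by simp [hμ, hω0.ne']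
  have hμc : conj μ = -μ := by simp [hμ]
  have re_deriv {g : ℝ → ℂ} {g' : ℂ} {t : ℝ} (hg : HasDerivAt g g' t) :
      HasDerivAt (fun t => (conj a * g t).re) (conj a * g').re t := by
    simpa [Function.comp_def] using
      Complex.reCLM.hasFDerivAt.comp_hasDerivAt t (hg.const_mul (conj a))
  have hd : (deriv fun t => (conj a * f t).re) = (fun t => (conj a * f' t).re) :=
    funext fun t => (re_deriv (hf t)).deriv
  refine ⟨⟨fun t => (re_deriv (hf t)).differentiableAt, ?_, fun t => ?_⟩, hd, ?_⟩
  · rw [hd]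
    exact fun t => (re_deriv (hf' t)).differentiableAt
  · rw [hd, (re_deriv (hf' t)).deriv, mul_left_comm, ← Complex.ofReal_neg, Complex.re_ofReal_mul]
    ring
  · have c1 := (Complex.continuous_conj.tendsto _).comp h1
    have c2 := (Complex.continuous_conj.tendsto _).comp h2
    -- Half of the real part comes from f and half from its conjugate. The f half enters the
    -- amplitude through f' + μ f, which decays, times a factor of modulus 1; only the conjugate
    -- half survives and gives a.
    have hosc : Tendsto (fun t : ℝ => Complex.exp (-(2 * μ * t)) *
        (Complex.exp (μ * t) * f' t + μ * (Complex.exp (μ * t) * f t))) atTop (𝓝 0) := by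
      have h3 := (h2.add (h1.const_mul μ)).norm
      rw [mul_one, neg_add_cancel, norm_zero] at h3
      rw [tendsto_zero_iff_norm_tendsto_zero]
      refine h3.congr fun t => ?_
      rw [norm_mul, Complex.norm_exp]
      simp [hμ]
    have hmain := ((hosc.const_mul (conj a / 2)).add
      ((c2.add (c1.const_mul μ)).const_mul (a / 2))).div_const μ
    have hval : (conj a / 2 * 0 + a / 2 * (conj (-μ) + μ * conj 1)) / μ = a := by
      rw [map_neg, hμc, map_one]
      field_simp
      ring
    rw [hval] at hmain
    refine hmain.congr fun t => ?_
    have e1 : Complex.exp (-(2 * μ * t)) = Complex.exp (-(μ * t)) * Complex.exp (-(μ * t)) := by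
      rw [← Complex.exp_add]
      ring_nf
    have e2 : Complex.exp (-(μ * t)) * Complex.exp (μ * t) = 1 := by
      rw [← Complex.exp_add]
      simp
    have e3 : conj (Complex.exp (μ * t)) = Complex.exp (-(μ * t)) := by
      rw [← Complex.exp_conj, map_mul, hμc, Complex.conj_ofReal, neg_mul]
    have r1 (x : ℂ) : ((x.re : ℝ) : ℂ) = (x + conj x) / 2 := by
      rw [Complex.add_conj]
      push_cast
      ring
    rw [amplitude, hd, ← hμ]
    simp only [r1, Function.comp_apply, map_mul, Complex.conj_conj, e1, e3]
    congr 1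
    linear_combination (conj a / 2 * Complex.exp (-(μ * t)) * (f' t + μ * f t)) * e2

/-- Normalized solutions of the limiting equation and their amplitudes at infinity. -/
theorem exists_limit_solutions (hω : ν * (ν + 1) < h) : ∃ (v₁ v₂ : ℝ → ℝ) (a b : ℂ),
    v₁ ∈ solutionSpace (limitCoeff h ν) ∧ v₂ ∈ solutionSpace (limitCoeff h ν) ∧
    v₁ 0 = 1 ∧ deriv v₁ 0 = 0 ∧ v₂ 0 = 0 ∧ deriv v₂ 0 = 1 ∧
    Tendsto (amplitude (lameOmega h ν) v₁) atTop (𝓝 a) ∧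
    Tendsto (amplitude (lameOmega h ν) v₂) atTop (𝓝 b) ∧
    Complex.I * lameOmega h ν * (a * b) = lameB h ν := by
  obtain ⟨f, f', hf, hf', h1, h2, hB⟩ := exists_jost_solution hω
  have hω0 := lameOmega_pos hω
  have hre := re_jost_solution hω hf hf' h1 h2
  set w := lameOmega h ν with hw
  set μ : ℂ := Complex.I * w with hμ
  have hμ0 : μ ≠ 0 := by simp [hμ, hω0.ne']
  have hμc : conj μ = -μ := by simp [hμ]
  have hd (t : ℝ) : HasDerivAt (fun t => f t * conj (f' t) - f' t * conj (f t)) 0 t := by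
    convert! ((hf t).mul (hf' t).star).sub ((hf' t).mul (hf t).star) using 1
    simp only [star_mul', RCLike.star_def, map_neg, Complex.conj_ofReal]
    ring
  have hconst (t : ℝ) := is_const_of_deriv_eq_zero (fun t => (hd t).differentiableAt)
    (fun t => (hd t).deriv) t 0
  -- The Wronskian of f and its conjugate is constant and is read off at infinity.
  have hW : f 0 * conj (f' 0) - f' 0 * conj (f 0) = 2 * μ := by
    have c1 := (Complex.continuous_conj.tendsto _).comp h1
    have c2 := (Complex.continuous_conj.tendsto _).comp h2
    have hlim := (h1.mul c2).sub (h2.mul c1)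
    rw [map_neg, hμc, map_one] at hlim
    have hval : 1 * -(-μ) - -μ * 1 = 2 * μ := by ring
    rw [hval] at hlim
    refine tendsto_nhds_unique (tendsto_const_nhds.congr fun t => ?_) hlim
    have e2 : Complex.exp (-(μ * t)) * Complex.exp (μ * t) = 1 := by
      rw [← Complex.exp_add]
      simp
    have e3 : conj (Complex.exp (μ * t)) = Complex.exp (-(μ * t)) := by
      rw [← Complex.exp_conj, map_mul, hμc, Complex.conj_ofReal, neg_mul]
    rw [← hconst t]
    simp only [Function.comp_apply, map_mul, e3]
    linear_combination (-(f t * conj (f' t) - f' t * conj (f t))) * e2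
  have hre0 {x : ℂ} {r : ℝ} (hx : x + conj x = 2 * r) : x.re = r := by
    rw [Complex.add_conj] at hx
    have : (2 * x.re : ℝ) = 2 * r := by exact_mod_cast hx
    linarith
  -- These amplitudes solve the initial conditions: the Wronskian 2μ yields the values 1, and the
  -- values 0 are real parts of |f'(0)|²/μ and of -|f(0)|²/μ, both purely imaginary.
  obtain ⟨p1, p2, p3⟩ := hre (-f' 0 / μ)
  obtain ⟨q1, q2, q3⟩ := hre (f 0 / μ)
  refine ⟨_, _, -f' 0 / μ, f 0 / μ, p1, q1, ?_, ?_, ?_, ?_, p3, q3, ?_⟩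
  · refine hre0 ?_
    simp only [map_mul, map_div₀, map_neg, hμc, Complex.conj_conj]
    push_cast
    field_simp
    linear_combination hW
  · rw [p2]
    refine hre0 ?_
    simp only [map_mul, map_div₀, map_neg, hμc, Complex.conj_conj]
    push_cast
    field_simp
    ring
  · refine hre0 ?_
    simp only [map_mul, map_div₀, hμc, map_neg, Complex.conj_conj]
    push_cast
    field_simp
    ring
  · rw [q2]
    refine hre0 ?_
    simp only [map_mul, map_div₀, hμc, map_neg, Complex.conj_conj]
    push_cast
    field_simp
    linear_combination hW
  · field_simp
    linear_combination hB

end Jost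

/-! ### Assembly of the discriminant estimate. -/

section Discriminant

variable {h ν k : ℝ}

/-- The exponentials cancel, leaving (y' + iωy)(z' + iωz)/(iω), whose cross terms form the real
part. -/
theorem re_amplitude_mul {ω : ℝ} (hω : 0 < ω) (y z : ℝ → ℝ) (t : ℝ) :
    (Complex.I * ω * (amplitude ω y t * amplitude ω z t) * Complex.exp (2 * Complex.I * ω * t)).re =
      y t * deriv z t + deriv y t * z t := by
  have hw : (ω : ℂ) ≠ 0 := by exact_mod_cast hω.ne'
  have e : Complex.exp (2 * Complex.I * ω * t) * (Complex.exp (-(Complex.I * ω * t)) *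
      Complex.exp (-(Complex.I * ω * t))) = 1 := by
    rw [← Complex.exp_add, ← Complex.exp_add, ← Complex.exp_zero]
    congr 1
    ring
  have key : Complex.I * ω * (amplitude ω y t * amplitude ω z t) *
      Complex.exp (2 * Complex.I * ω * t) = (y t * deriv z t + deriv y t * z t : ℝ) +
        (ω * y t * z t - deriv y t * deriv z t / ω : ℝ) * Complex.I := by
    have : Complex.I * ω * (amplitude ω y t * amplitude ω z t) *
        Complex.exp (2 * Complex.I * ω * t) = (deriv y t + Complex.I * ω * y t) *
          (deriv z t + Complex.I * ω * z t) / (Complex.I * ω) * (Complex.exp (2 * Complex.I * ω * t)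
          * (Complex.exp (-(Complex.I * ω * t)) * Complex.exp (-(Complex.I * ω * t)))) := by
      simp only [amplitude]
      field_simp
    rw [this, e, mul_one, div_eq_iff (mul_ne_zero Complex.I_ne_zero hw)]
    push_cast
    field_simp
    linear_combination (deriv y t * deriv z t : ℂ) * Complex.I_sq
  rw [key]
  simp

/-- Split αβ - ab = (α - a)β + a(β - b); each term is at most A₁A₂δ, and the prefactor is 2ω. -/
theorem abs_discriminant_sub_le {K : ℝ} {ω A₁ A₂ δ D : ℝ} {α β a b B : ℂ} (hω : 0 < ω)
    (hD : D = 2 * (Complex.I * ω * (α * β) * Complex.exp (2 * Complex.I * ω * K)).re)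
    (hB : Complex.I * ω * (a * b) = B) (ha : ‖a‖ ≤ A₁) (hβ : ‖β‖ ≤ A₂) (hαa : ‖α - a‖ ≤ A₁ * δ)
    (hβb : ‖β - b‖ ≤ A₂ * δ) :
    |D - 2 * (B * Complex.exp (2 * Complex.I * ω * K)).re| ≤ 4 * ω * (A₁ * A₂ * δ) := by
  have h1 : ‖Complex.exp (2 * Complex.I * ω * K)‖ = 1 := by
    rw [Complex.norm_exp]
    simp
  have h2 : D - 2 * (B * Complex.exp (2 * Complex.I * ω * K)).re =
      2 * (Complex.I * ω * (α * β - a * b) * Complex.exp (2 * Complex.I * ω * K)).re := by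
    rw [hD, ← hB, ← mul_sub, ← Complex.sub_re]
    ring_nf
  have h3 : ‖α * β - a * b‖ ≤ A₁ * δ * A₂ + A₁ * (A₂ * δ) := by
    rw [show α * β - a * b = (α - a) * β + a * (β - b) by ring]
    refine (norm_add_le _ _).trans ?_
    rw [norm_mul, norm_mul]
    exact add_le_add (mul_le_mul hαa hβ (norm_nonneg _) ((norm_nonneg _).trans hαa))
      (mul_le_mul ha hβb (norm_nonneg _) ((norm_nonneg _).trans ha))
  rw [h2, abs_mul, abs_two]
  calc 2 * |(Complex.I * ω * (α * β - a * b) * Complex.exp (2 * Complex.I * ω * K)).re|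
      ≤ 2 * ‖Complex.I * ω * (α * β - a * b) * Complex.exp (2 * Complex.I * ω * K)‖ := by
        gcongr
        exact Complex.abs_re_le_norm _
    _ = 2 * (ω * ‖α * β - a * b‖) := by
        rw [norm_mul, h1, norm_mul, norm_mul, Complex.norm_I, Complex.norm_real,
          Real.norm_of_nonneg hω.le, one_mul, mul_one]
    _ ≤ 2 * (ω * (A₁ * δ * A₂ + A₁ * (A₂ * δ))) := by gcongr
    _ = _ := by ring

theorem exists_lame_solutions (hω : ν * (ν + 1) < h) (hk : k ∈ Set.Ioo (0 : ℝ) 1) :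
    ∃ y₁ ∈ solutionSpace (lameCoeff h ν k), ∃ y₂ ∈ solutionSpace (lameCoeff h ν k),
      y₁ 0 = 1 ∧ deriv y₁ 0 = 0 ∧ y₂ 0 = 0 ∧ deriv y₂ 0 = 1 ∧
      lameDiscriminant h ν k hk = 2 * (Complex.I * lameOmega h ν *
        (amplitude (lameOmega h ν) y₁ (ellipticK k) * amplitude (lameOmega h ν) y₂ (ellipticK k)) *
        Complex.exp (2 * Complex.I * lameOmega h ν * ellipticK k)).re := by
  obtain ⟨y, hy, hy0, hy1⟩ := exists_hill_solution (continuous_lameCoeff (h := h) (ν := ν) hk)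
    (abs_lameCoeff_le hk) 1 0
  obtain ⟨z, hz, hz0, hz1⟩ := exists_hill_solution (continuous_lameCoeff (h := h) (ν := ν) hk)
    (abs_lameCoeff_le hk) 0 1
  refine ⟨y, hy, z, hz, hy0, hy1, hz0, hz1, ?_⟩
  rw [re_amplitude_mul (lameOmega_pos hω), lameDiscriminant,
    hillDiscriminant_eq (abs_lameCoeff_le hk) (lameCoeff_neg hk) _ hy hz hy0 hy1 hz0 hz1]

/-- The initial energies √(v'² + h v²) are √h and 1 for the even and odd solution, so A₁ = √h/ω, A₂
= 1/ω, and δ carries a further 1/ω. -/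
theorem abs_lameDiscriminant_sub_le_of_nonneg (hν : 0 ≤ ν * (ν + 1)) (hω : ν * (ν + 1) < h)
    (hk : k ∈ Set.Ioo (0 : ℝ) 1) :
    |lameDiscriminant h ν k hk - 2 * (lameB h ν *
      Complex.exp (2 * Complex.I * lameOmega h ν * ellipticK k)).re| ≤
      4 * √h / lameOmega h ν ^ 2 * (ν * (ν + 1)) *
        (ellipticE k + 1 - 2 * Real.tanh (ellipticK k)) := by
  obtain ⟨v₁, v₂, a, b, hv₁, hv₂, p1, p2, p3, p4, ha, hb, hB⟩ := exists_limit_solutions hω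
  obtain ⟨y₁, hy₁, y₂, hy₂, q1, q2, q3, q4, hD⟩ := exists_lame_solutions hω hk
  have hω0 := lameOmega_pos hω
  obtain ⟨-, s2, s3⟩ := amplitude_bounds_of_nonneg (R := √h) hω hν hk hy₁ hv₁ ha (by rw [p1, q1])
    (by rw [p2, q2]) (by simp [p1, p2])
  obtain ⟨r1, -, r3⟩ := amplitude_bounds_of_nonneg (R := 1) hω hν hk hy₂ hv₂ hb (by rw [p3, q3])
    (by rw [p4, q4]) (by simp [p3, p4])
  refine (abs_discriminant_sub_le hω0 hD hB s2 r1 s3 r3).trans (le_of_eq ?_)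
  rw [abs_of_nonneg hν]
  field_simp

/-- The initial energies √(v² + v'²/h) are 1 and 1/√h, and δ carries a further 1/√h, which gives
ω/h. -/
theorem abs_lameDiscriminant_sub_le_of_neg (hν : ν * (ν + 1) < 0) (hh : 0 < h)
    (hk : k ∈ Set.Ioo (0 : ℝ) 1) :
    |lameDiscriminant h ν k hk - 2 * (lameB h ν *
      Complex.exp (2 * Complex.I * lameOmega h ν * ellipticK k)).re| ≤
      4 * lameOmega h ν / h * |ν * (ν + 1)| *
        (ellipticE k + 1 - 2 * Real.tanh (ellipticK k)) := by
  have hω := hν.trans hh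
  obtain ⟨v₁, v₂, a, b, hv₁, hv₂, p1, p2, p3, p4, ha, hb, hB⟩ := exists_limit_solutions hω
  obtain ⟨y₁, hy₁, y₂, hy₂, q1, q2, q3, q4, hD⟩ := exists_lame_solutions hω hk
  obtain ⟨-, s2, s3⟩ := amplitude_bounds_of_neg (R := 1) hh hν hk hy₁ hv₁ ha (by rw [p1, q1])
    (by rw [p2, q2]) (by simp [p1, p2])
  obtain ⟨r1, -, r3⟩ := amplitude_bounds_of_neg (R := 1 / √h) hh hν hk hy₂ hv₂ hb
    (by rw [p3, q3]) (by rw [p4, q4]) (by simp [p3, p4])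
  refine (abs_discriminant_sub_le (lameOmega_pos hω) hD hB s2 r1 s3 r3).trans (le_of_eq ?_)
  have hs := Real.sqrt_pos.2 hh
  have hs2 := Real.sq_sqrt hh.le
  field_simp
  rw [hs2]
  field_simp

end Discriminant

end Lame

end

theorem theorem3 (h ν : ℝ) :
    (0 ≤ ν → ν * (ν + 1) < h → ∀ (k : ℝ) (hk : k ∈ Set.Ioo (0 : ℝ) 1),
      |Lame.lameDiscriminant h ν k hk -
          2 * (Lame.lameB h ν *
            Complex.exp (2 * Complex.I * Lame.lameOmega h ν * Lame.ellipticK k)).re| ≤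
        8 * √h / Lame.lameOmega h ν ^ 2 * (ν * (ν + 1)) *
          (Lame.ellipticE k + 1 - 2 * Real.tanh (Lame.ellipticK k))) ∧
    (-(1 / 2) ≤ ν → ν < 0 → 0 < h → ∀ (k : ℝ) (hk : k ∈ Set.Ioo (0 : ℝ) 1),
      |Lame.lameDiscriminant h ν k hk -
          2 * (Lame.lameB h ν *
            Complex.exp (2 * Complex.I * Lame.lameOmega h ν * Lame.ellipticK k)).re| ≤
        8 * Lame.lameOmega h ν / h * (|ν| * (ν + 1)) *
          (Lame.ellipticE k + 1 - 2 * Real.tanh (Lame.ellipticK k))) := by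
  constructor
  · intro hν hω k hk
    have key := Lame.abs_lameDiscriminant_sub_le_of_nonneg (by positivity) hω hk
    have h0 := (abs_nonneg _).trans key
    -- The estimate holds with 4 in place of 8. Its right side is nonnegative, as it bounds an
    -- absolute value, so it may be doubled.
    refine key.trans (le_of_le_of_eq (le_mul_of_one_le_left h0 one_le_two) ?_)
    ring
  · intro hν hν0 hh k hk
    have key := Lame.abs_lameDiscriminant_sub_le_of_neg (by nlinarith : ν * (ν + 1) < 0) hh hk
    have h0 := (abs_nonneg _).trans key
    refine key.trans (le_of_le_of_eq (le_mul_of_one_le_left h0 one_le_two) ?_)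
    rw [abs_mul, abs_of_pos (by linarith : 0 < ν + 1)]
    ring
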